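/- Let $\mathbb D=\{z\in\mathbb C:|z|<1\}$. For $\sigma\in\partial\mathbb D$ and $f:\mathbb D\to\mathbb C$, let $f(\sigma)$ denote the angular (non-tangential) limit $\angle\lim_{z\to\sigma}f(z)$ and $f'(\sigma)$ the angular derivative $\angle\lim_{z\to\sigma}\frac{f(z)-f(\sigma)}{z-\sigma}$, when they exist. The point $\sigma$ is a boundary regular fixed point of a holomorphic self-map $f$ of $\mathbb D$ if $f(\sigma)$ exists, $f(\sigma)=\sigma$, and $f'(\sigma)$ exists and is finite. For $F\subset\partial\mathbb D$, let $\mathfrak P[F]$ be the class of all holomorphic maps $f:\mathbb D\to\mathbb D$ for which every $\sigma\in F$ is a boundary regular fixed point. An evolution family is a family $(\varphi_{s,t})_{0\le s\le t}$ of holomorphic self-maps of $\mathbb D$ such that EF1. $\varphi_{s,s}=\mathrm{id}_{\mathbb D}$ for all $s\ge0$; EF2. $\varphi_{s,t}=\varphi_{u,t}\circ\varphi_{s,u}$ whenever $0\le s\le u\le t$; EF3. for all $z\in\mathbb D$ and $T>0$ there is an integrable function $k_{z,T}:[0,T]\to[0,+\infty)$ such that $|\varphi_{s,u}(z)-\varphi_{s,t}(z)|\le\int_u^t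 k_{z,T}(\xi)\,d\xi$ whenever $0\le s\le u\le t\le T$. Let $\sigma_1\ne\sigma_2$ be two points of $\partial\mathbb D$ and let $(\varphi_{s,t})_{0\le s\le t}$ be a family in $\mathfrak P[\{\sigma_1,\sigma_2\}]$ satisfying EF1 and EF2. Then $\varphi_{0,t}'(\sigma_j)\in(0,+\infty)$ for all $t\ge0$ and $j=1,2$, and the following two assertions are equivalent: (i) $(\varphi_{s,t})$ is an evolution family; (ii) both functions $[0,+\infty)\ni t\mapsto\varphi_{0,t}'(\sigma_j)\in(0,+\infty)$, $j=1,2$, are locally absolutely continuous, that is, absolutely continuous on every compact subinterval of $[0,+\infty)$. -/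

import Mathlib

open Set Filter Topology MeasureTheory

namespace Loewner

/-- The open unit disk `𝔻 ⊂ ℂ`. -/
def disk : Set ℂ := Metric.ball (0 : ℂ) 1

/-- The unit circle `∂𝔻`. -/
def circle : Set ℂ := Metric.sphere (0 : ℂ) 1

/-- `f` restricts to a holomorphic self-map of the unit disk. Only the values of `f` in the
disk are relevant, here and in all the notions below. -/
def IsHolSelfMap (f : ℂ → ℂ) : Prop :=
  DifferentiableOn ℂ f disk ∧ MapsTo f disk disk

/-- The Stolz (non-tangential approach) region of aperture `M` with vertex `σ`. -/
def stolzRegion (σ : ℂ) (M : ℝ) : Set ℂ :=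
  {z | z ∈ disk ∧ ‖σ - z‖ < M * (1 - ‖z‖)}

/-- The filter of angular (non-tangential) approach to `σ`: convergence along it is convergence
as `z → σ` within every Stolz region with vertex `σ`. -/
noncomputable def angularFilter (σ : ℂ) : Filter ℂ := ⨆ M : ℝ, 𝓝[stolzRegion σ M] σ

/-- The angular limit of `f` at `σ` exists and equals `l`. -/
def HasAngularLimit (f : ℂ → ℂ) (σ l : ℂ) : Prop :=
  Tendsto f (angularFilter σ) (𝓝 l)

/-- The angular limit `f(σ)` (meaningful when it exists). -/
noncomputable def angularLimit (f : ℂ → ℂ) (σ : ℂ) : ℂ :=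
  limUnder (angularFilter σ) f

/-- The angular limit `f(σ)` exists, and `f` has at `σ` the finite angular derivative `d`. -/
def HasAngularDeriv (f : ℂ → ℂ) (σ d : ℂ) : Prop :=
  ∃ l : ℂ, HasAngularLimit f σ l ∧ HasAngularLimit (fun z => (f z - l) / (z - σ)) σ d

/-- The angular derivative `f'(σ)` (meaningful when it exists and is finite). -/
noncomputable def angularDeriv (f : ℂ → ℂ) (σ : ℂ) : ℂ :=
  angularLimit (fun z => (f z - angularLimit f σ) / (z - σ)) σ

/-- `σ` is a regular contact point of `f`: the angular limit of `f` at `σ` exists and lies on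
the unit circle, and `f` has a finite angular derivative at `σ`. -/
def IsRegularContactPoint (f : ℂ → ℂ) (σ : ℂ) : Prop :=
  (∃ l ∈ circle, HasAngularLimit f σ l) ∧ ∃ d : ℂ, HasAngularDeriv f σ d

/-- `σ` is a boundary regular fixed point of `f`. -/
def IsBRFP (f : ℂ → ℂ) (σ : ℂ) : Prop :=
  IsRegularContactPoint f σ ∧ HasAngularLimit f σ σ

/-- The class `𝔓[F]` of holomorphic self-maps of the disk for which every point of `F` is a
boundary regular fixed point. -/
def classP (F : Set ℂ) : Set (ℂ → ℂ) :=
  {f | IsHolSelfMap f ∧ ∀ σ ∈ F, IsBRFP f σ}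

/-- `φ s s` is the identity of the disk for all `s ≥ 0`. A family indexed by `0 ≤ s ≤ t` is
given as a function of two real variables, of which only the values at `0 ≤ s ≤ t` matter. -/
def EF1 (φ : ℝ → ℝ → ℂ → ℂ) : Prop :=
  ∀ s : ℝ, 0 ≤ s → ∀ z ∈ disk, φ s s z = z

/-- `φ s t = φ u t ∘ φ s u` on the disk whenever `0 ≤ s ≤ u ≤ t`. -/
def EF2 (φ : ℝ → ℝ → ℂ → ℂ) : Prop :=
  ∀ s u t : ℝ, 0 ≤ s → s ≤ u → u ≤ t → ∀ z ∈ disk, φ s t z = φ u t (φ s u z)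

/-- The absolute continuity condition on evolution families. -/
def EF3 (φ : ℝ → ℝ → ℂ → ℂ) : Prop :=
  ∀ z ∈ disk, ∀ T : ℝ, 0 < T →
    ∃ k : ℝ → ℝ, (∀ ξ ∈ Icc 0 T, 0 ≤ k ξ) ∧ IntegrableOn k (Icc 0 T) volume ∧
      ∀ s u t : ℝ, 0 ≤ s → s ≤ u → u ≤ t → t ≤ T →
        ‖φ s u z - φ s t z‖ ≤ ∫ ξ in u..t, k ξ

/-- `(φ s t)` with `0 ≤ s ≤ t` is an evolution family in the unit disk. -/
structure IsEvolutionFamily (φ : ℝ → ℝ → ℂ → ℂ) : Prop where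
  holo : ∀ s t : ℝ, 0 ≤ s → s ≤ t → IsHolSelfMap (φ s t)
  ef1 : EF1 φ
  ef2 : EF2 φ
  ef3 : EF3 φ

/-- `f` is locally absolutely continuous on `[0, +∞)`, that is, absolutely continuous on every
compact interval `[a, b] ⊂ [0, +∞)`. -/
def LocallyAC (f : ℝ → ℂ) : Prop :=
  ∀ a b : ℝ, 0 ≤ a → a ≤ b → AbsolutelyContinuousOnInterval f a b

/-- Angular approach to a point of the unit circle is possible. -/
theorem angularFilter_neBot {σ : ℂ} (hσ : σ ∈ circle) : (angularFilter σ).NeBot := by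
  have h1 : ‖σ‖ = 1 := by simpa [circle] using hσ
  suffices h : (𝓝[stolzRegion σ 2] σ).NeBot from
    h.mono (le_iSup (fun M : ℝ => 𝓝[stolzRegion σ M] σ) 2)
  rw [← mem_closure_iff_nhdsWithin_neBot]
  have ht : Tendsto (fun r : ℝ => (r : ℂ) * σ) (𝓝[<] (1 : ℝ)) (𝓝 σ) := by
    have hc : Continuous fun r : ℝ => (r : ℂ) * σ := by fun_prop
    have := hc.tendsto 1
    simp only [Complex.ofReal_one, one_mul] at this
    exact this.mono_left nhdsWithin_le_nhds
  refine mem_closure_of_tendsto ht ?_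
  filter_upwards [Ioo_mem_nhdsLT (show (0 : ℝ) < 1 by norm_num)] with r hr
  have hn : ‖(r : ℂ) * σ‖ = r := by
    rw [norm_mul, h1, mul_one, Complex.norm_real, Real.norm_of_nonneg hr.1.le]
  have hd : ‖σ - (r : ℂ) * σ‖ = 1 - r := by
    rw [show σ - (r : ℂ) * σ = ((1 - r : ℝ) : ℂ) * σ by push_cast; ring, norm_mul, h1, mul_one,
      Complex.norm_real, Real.norm_of_nonneg (by linarith [hr.2])]
  refine ⟨?_, ?_⟩
  · rw [disk, mem_ball_zero_iff, hn]; exact hr.2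
  · rw [hn, hd]; linarith [hr.2]

/-- The angular derivative, when it exists and is finite, is the value of `angularDeriv`. -/
theorem HasAngularDeriv.angularDeriv_eq {f : ℂ → ℂ} {σ d : ℂ} (hσ : σ ∈ circle)
    (h : HasAngularDeriv f σ d) : angularDeriv f σ = d := by
  have := angularFilter_neBot hσ
  obtain ⟨l, hl, hd⟩ := h
  have e : angularLimit f σ = l := hl.limUnder_eq
  unfold angularDeriv
  rw [e]
  exact hd.limUnder_eq

end Loewner

namespace Loewner

/-! A Möbius chart sends `σ₁` to `∞` and `σ₂` to `0`, and turns each `φ s t` into a self-map `F` of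
the right half-plane. Write `d₁`, `d₂` for its angular derivatives at `σ₁`, `σ₂`. Julia's lemma, the
boundary limit of Schwarz–Pick, gives `Re (1/w) ≤ d₂ Re (1/F w)` at `0` and `Re w ≤ d₁ Re (F w)` at
`∞`. By the chain rule both derivatives are multiplicative along the family.

From (ii) to (i): `F w - w/d₁` has nonnegative real part and derivative `d₂ - 1/d₁` at `0`. Julia's
lemma for this difference (`IsHalfPlaneMap.norm_sub_mul_le`) bounds the displacement `|F w - w|` by
`|d₂ - 1|` and `|1/d₁ - 1|`, hence by increments of the two derivative functions. Julia's
inequalities also keep the orbit of a point in a fixed compact set for times in `[0, T]`, so the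
bound is uniform and EF3 follows.

From (i) to (ii): let `ℓ t` be the derivative of `φ 0 t` at `σ₂`, and `R x t = x Re (1/F t x)` for
`x > 0`. By Julia's lemma `ℓ t * R x t` is nondecreasing in `t`. It equals `1` at `t = 0`, and at `t
= T` it tends to `1` as `x → 0`, so its variation on `[0, T]` is as small as desired. Since `R x` is
absolutely continuous by EF3, so is `ℓ` (`absolutelyContinuousOnInterval_of_dist_le`). Exchanging
the two points handles `σ₁`. -/

/-- The right half-plane. -/
def halfPlane : Set ℂ := {w | 0 < w.re}

/-- The cone of approach to `0` in the right half-plane. -/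
def cone (c : ℝ) : Set ℂ := {w | 0 < w.re ∧ c * ‖w‖ ≤ w.re}

/-- `F w / w` tends to `d` as `w → 0` within every cone in the right half-plane. -/
def HasConeDeriv (F : ℂ → ℂ) (d : ℂ) : Prop :=
  ∀ c : ℝ, 0 < c → Tendsto (fun w => F w / w) (𝓝[cone c] 0) (𝓝 d)

/-- `F` restricts to a holomorphic self-map of the right half-plane. -/
def IsHalfPlaneMap (F : ℂ → ℂ) : Prop :=
  DifferentiableOn ℂ F halfPlane ∧ MapsTo F halfPlane halfPlane

/-! ### Schwarz–Pick lemma in the half-plane -/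

theorem sq_norm_add_conj (p q : ℂ) :
    ‖p + (starRingEnd ℂ) q‖ ^ 2 = ‖p - q‖ ^ 2 + 4 * (p.re * q.re) := by
  simp only [Complex.sq_norm, Complex.normSq_apply, Complex.add_re, Complex.add_im,
    Complex.sub_re, Complex.sub_im, Complex.conj_re, Complex.conj_im]
  ring

theorem add_conj_ne_zero {p q : ℂ} (hp : p ∈ halfPlane) (hq : q ∈ halfPlane) :
    p + (starRingEnd ℂ) q ≠ 0 := by
  intro h
  have := congrArg Complex.re h
  simp only [Complex.add_re, Complex.conj_re, Complex.zero_re] at this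
  have h1 : 0 < p.re := hp
  have h2 : 0 < q.re := hq
  linarith

theorem norm_sub_lt_norm_add_conj {p q : ℂ} (hp : p ∈ halfPlane) (hq : q ∈ halfPlane) :
    ‖p - q‖ < ‖p + (starRingEnd ℂ) q‖ := by
  refine lt_of_pow_lt_pow_left₀ 2 (norm_nonneg _) ?_
  rw [sq_norm_add_conj]
  have : 0 < p.re * q.re := mul_pos hp hq
  linarith

/-- This is the Schwarz lemma for `g`, which is `F` read between Cayley charts centred at `w` and `F
w`, evaluated at the point `ζ` corresponding to `z`. -/
theorem IsHalfPlaneMap.schwarz_pick_norm {F : ℂ → ℂ} (hF : IsHalfPlaneMap F) {z w : ℂ}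
    (hz : z ∈ halfPlane) (hw : w ∈ halfPlane) :
    ‖F z - F w‖ * ‖z + (starRingEnd ℂ) w‖ ≤ ‖z - w‖ * ‖F z + (starRingEnd ℂ) (F w)‖ := by
  set ψ : ℂ → ℂ := fun ζ => (w + (starRingEnd ℂ) w * ζ) / (1 - ζ) with hψ
  have hne : ∀ ζ ∈ Metric.ball (0 : ℂ) 1, 1 - ζ ≠ 0 := by
    intro ζ hζ h
    rw [mem_ball_zero_iff, ← sub_eq_zero.mp h] at hζ
    simp at hζ
  have hψH : MapsTo ψ (Metric.ball 0 1) halfPlane := by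
    intro ζ hζ
    have h1 := hne ζ hζ
    rw [mem_ball_zero_iff] at hζ
    have h2 : 0 < ‖1 - ζ‖ := norm_pos_iff.mpr h1
    have h3 : (ψ ζ).re = w.re * (1 - ‖ζ‖ ^ 2) / ‖1 - ζ‖ ^ 2 := by
      rw [hψ]
      simp only [Complex.div_re, Complex.sq_norm]
      rw [← add_div]
      congr 1
      simp only [Complex.normSq_apply, Complex.add_re, Complex.mul_re, Complex.conj_re,
        Complex.conj_im, Complex.sub_re, Complex.one_re, Complex.add_im, Complex.mul_im,
        Complex.sub_im, Complex.one_im]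
      ring
    show 0 < (ψ ζ).re
    rw [h3]
    have h4 : 0 < w.re := hw
    have : ‖ζ‖ ^ 2 < 1 := by nlinarith [norm_nonneg ζ]
    have : 0 < 1 - ‖ζ‖ ^ 2 := by linarith
    positivity
  have hψd : DifferentiableOn ℂ ψ (Metric.ball 0 1) := by
    refine DifferentiableOn.div (by fun_prop) (by fun_prop) hne
  have hFw := hF.2 hw
  set g : ℂ → ℂ := fun ζ => (F (ψ ζ) - F w) / (F (ψ ζ) + (starRingEnd ℂ) (F w)) with hg
  have hFψ : DifferentiableOn ℂ (fun ζ => F (ψ ζ)) (Metric.ball 0 1) := hF.1.comp hψd hψH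
  have hgd : DifferentiableOn ℂ g (Metric.ball 0 1) := by
    refine DifferentiableOn.div (hFψ.sub_const _) (hFψ.add_const _) ?_
    exact fun ζ hζ => add_conj_ne_zero (hF.2 (hψH hζ)) hFw
  have hgm : MapsTo g (Metric.ball 0 1) (Metric.closedBall 0 1) := by
    intro ζ hζ
    rw [mem_closedBall_zero_iff, hg]
    simp only [norm_div]
    exact div_le_one_of_le₀ (norm_sub_lt_norm_add_conj (hF.2 (hψH hζ)) hFw).le (norm_nonneg _)
  have hg0 : g 0 = 0 := by simp [hg, hψ]
  have hzw := add_conj_ne_zero hz hw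
  set ζ := (z - w) / (z + (starRingEnd ℂ) w) with hζ
  have hζ1 : ‖ζ‖ < 1 := by
    rw [hζ, norm_div, div_lt_one (norm_pos_iff.mpr hzw)]
    exact norm_sub_lt_norm_add_conj hz hw
  have hψζ : ψ ζ = z := by
    have h1 : 1 - ζ ≠ 0 := hne ζ (by simpa using hζ1)
    rw [hψ]
    simp only
    rw [div_eq_iff h1, hζ]
    field_simp
    ring
  have key := Complex.norm_le_norm_of_mapsTo_ball hgd hgm hg0 hζ1
  rw [hg] at key
  simp only [hψζ] at key
  rwa [hζ, norm_div, norm_div, div_le_div_iff₀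
    (norm_pos_iff.mpr (add_conj_ne_zero (hF.2 hz) hFw)) (norm_pos_iff.mpr hzw)] at key

/-- The **Schwarz–Pick lemma** in the right half-plane. -/
theorem IsHalfPlaneMap.schwarz_pick {F : ℂ → ℂ} (hF : IsHalfPlaneMap F) {z w : ℂ}
    (hz : z ∈ halfPlane) (hw : w ∈ halfPlane) :
    ‖F z + (starRingEnd ℂ) (F w)‖ ^ 2 * (z.re * w.re) ≤
      ‖z + (starRingEnd ℂ) w‖ ^ 2 * ((F z).re * (F w).re) := by
  have h := pow_le_pow_left₀ (by positivity) (hF.schwarz_pick_norm hz hw) 2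
  rw [mul_pow, mul_pow] at h
  have e1 := sq_norm_add_conj z w
  have e2 := sq_norm_add_conj (F z) (F w)
  have e3 : ‖z - w‖ ^ 2 = ‖z + (starRingEnd ℂ) w‖ ^ 2 - 4 * (z.re * w.re) := by linarith
  have e4 : ‖F z - F w‖ ^ 2 = ‖F z + (starRingEnd ℂ) (F w)‖ ^ 2 - 4 * ((F z).re * (F w).re) := by
    linarith
  rw [e3, e4] at h
  linarith

/-! ### Boundary derivatives and Julia's lemma -/

theorem HasConeDeriv.tendsto_comp {F : ℂ → ℂ} {d : ℂ} (h : HasConeDeriv F d) {ι : Type*}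
    {l : Filter ι} {u : ι → ℂ} {c : ℝ} (hc : 0 < c) (hu : Tendsto u l (𝓝 0))
    (huc : ∀ᶠ i in l, u i ∈ cone c) : Tendsto (fun i => F (u i) / u i) l (𝓝 d) :=
  (h c hc).comp (tendsto_nhdsWithin_iff.mpr ⟨hu, huc⟩)

theorem mul_mem_cone {v : ℂ} (hv : v ∈ halfPlane) {x : ℝ} (hx : 0 < x) :
    (x : ℂ) * v ∈ cone (v.re / ‖v‖) := by
  have h : 0 < v.re := hv
  have hn : 0 < ‖v‖ := lt_of_lt_of_le h (Complex.re_le_norm v)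
  refine ⟨?_, ?_⟩
  · rw [Complex.re_ofReal_mul]; positivity
  · rw [Complex.re_ofReal_mul, norm_mul, Complex.norm_real, Real.norm_of_nonneg hx.le]
    apply le_of_eq
    field_simp

theorem HasConeDeriv.tendsto_ray {F : ℂ → ℂ} {d : ℂ} (h : HasConeDeriv F d) {v : ℂ}
    (hv : v ∈ halfPlane) :
    Tendsto (fun x : ℝ => F ((x : ℂ) * v) / ((x : ℂ) * v)) (𝓝[>] 0) (𝓝 d) := by
  have h0 : 0 < v.re := hv
  have hn : 0 < ‖v‖ := lt_of_lt_of_le h0 (Complex.re_le_norm v)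
  refine h.tendsto_comp (c := v.re / ‖v‖) (by positivity) ?_ ?_
  · have hc : Continuous fun x : ℝ => (x : ℂ) * v := by fun_prop
    have := hc.tendsto 0
    simp only [Complex.ofReal_zero, zero_mul] at this
    exact this.mono_left nhdsWithin_le_nhds
  · filter_upwards [self_mem_nhdsWithin] with x hx using mul_mem_cone hv hx

theorem HasConeDeriv.tendsto_real {F : ℂ → ℂ} {d : ℂ} (h : HasConeDeriv F d) :
    Tendsto (fun x : ℝ => F (x : ℂ) / (x : ℂ)) (𝓝[>] 0) (𝓝 d) := by
  simpa using h.tendsto_ray (v := 1) (by simp [halfPlane])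

theorem tendsto_ofReal_nhdsGT_zero : Tendsto (fun x : ℝ => (x : ℂ)) (𝓝[>] 0) (𝓝 0) := by
  have := Complex.continuous_ofReal.tendsto 0
  simp only [Complex.ofReal_zero] at this
  exact this.mono_left nhdsWithin_le_nhds

theorem HasConeDeriv.tendsto_zero {F : ℂ → ℂ} {d : ℂ} (h : HasConeDeriv F d) :
    Tendsto (fun x : ℝ => F (x : ℂ)) (𝓝[>] 0) (𝓝 0) := by
  have := h.tendsto_real.mul tendsto_ofReal_nhdsGT_zero
  rw [mul_zero] at this
  refine this.congr' ?_
  filter_upwards [self_mem_nhdsWithin] with x hx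
  have : (x : ℂ) ≠ 0 := by exact_mod_cast (ne_of_gt hx)
  field_simp

theorem HasConeDeriv.tendsto_re_div {F : ℂ → ℂ} {d : ℂ} (h : HasConeDeriv F d) :
    Tendsto (fun x : ℝ => (F (x : ℂ)).re / x) (𝓝[>] 0) (𝓝 d.re) := by
  have := (Complex.continuous_re.tendsto d).comp h.tendsto_real
  refine this.congr fun x => ?_
  simp [Complex.div_ofReal_re]

/-- **Julia's lemma** at the boundary point `0` of the right half-plane. -/
theorem IsHalfPlaneMap.julia {F : ℂ → ℂ} (hF : IsHalfPlaneMap F) {d : ℂ}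
    (h : HasConeDeriv F d) {z : ℂ} (hz : z ∈ halfPlane) :
    ‖F z‖ ^ 2 * z.re ≤ d.re * ‖z‖ ^ 2 * (F z).re := by
  -- Schwarz–Pick for `z` and a real `x > 0`, divided by `x`; then `x → 0`.
  have h1 : Tendsto (fun x : ℝ => ‖F z + (starRingEnd ℂ) (F x)‖ ^ 2 * z.re) (𝓝[>] 0)
      (𝓝 (‖F z + (starRingEnd ℂ) 0‖ ^ 2 * z.re)) :=
    ((((Complex.continuous_conj.tendsto 0).comp h.tendsto_zero).const_add _).norm.pow 2).mul_const _
  have h2 : Tendsto (fun x : ℝ => ‖z + (starRingEnd ℂ) (x : ℂ)‖ ^ 2 *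
      ((F z).re * ((F x).re / x))) (𝓝[>] 0)
      (𝓝 (‖z + (starRingEnd ℂ) 0‖ ^ 2 * ((F z).re * d.re))) :=
    ((((Complex.continuous_conj.tendsto 0).comp tendsto_ofReal_nhdsGT_zero).const_add
      _).norm.pow 2).mul (h.tendsto_re_div.const_mul _)
  have h3 := le_of_tendsto_of_tendsto h1 h2 (by
    filter_upwards [self_mem_nhdsWithin] with x hx
    have hx : 0 < x := hx
    have := hF.schwarz_pick hz (show (x : ℂ) ∈ halfPlane by simpa [halfPlane] using hx)
    rw [Complex.ofReal_re] at this
    rw [← mul_div_assoc, ← mul_div_assoc, le_div_iff₀ hx]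
    linarith)
  simp only [map_zero, add_zero] at h3
  linarith

/-- The derivative of a half-plane map at a boundary fixed point is a positive number. -/
theorem IsHalfPlaneMap.exists_pos {F : ℂ → ℂ} (hF : IsHalfPlaneMap F) {d : ℂ}
    (h : HasConeDeriv F d) : ∃ r : ℝ, 0 < r ∧ d = r := by
  -- `d * v` is the limit of `F (x v) / x`, whose real part is positive.
  have hre : ∀ v ∈ halfPlane, 0 ≤ (d * v).re := by
    intro v hv
    have h1 := (Complex.continuous_re.tendsto _).comp ((h.tendsto_ray hv).mul_const v)
    refine ge_of_tendsto h1 ?_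
    filter_upwards [self_mem_nhdsWithin] with x hx
    have hx : 0 < x := hx
    have hxv : (x : ℂ) * v ∈ halfPlane := by
      show 0 < ((x : ℂ) * v).re
      rw [Complex.re_ofReal_mul]; exact mul_pos hx hv
    have hv0 : v ≠ 0 := by rintro rfl; simp [halfPlane] at hv
    have hx0 : (x : ℂ) ≠ 0 := by exact_mod_cast hx.ne'
    have e : F ((x : ℂ) * v) / ((x : ℂ) * v) * v = F ((x : ℂ) * v) / (x : ℂ) := by
      field_simp
    simp only [Function.comp_apply]
    rw [e, Complex.div_ofReal_re]
    exact div_nonneg (le_of_lt (hF.2 hxv)) hx.le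
  -- Let `v` approach the imaginary axis at `i y`; taking both signs of `y` gives `d.im = 0`.
  have him : ∀ y : ℝ, d.im * y ≤ 0 := by
    intro y
    refine le_of_forall_pos_le_add fun ε hε => ?_
    have hδ : 0 < ε / (|d.re| + 1) := by positivity
    have := hre ⟨ε / (|d.re| + 1), y⟩ hδ
    simp only [Complex.mul_re] at this
    have h2 : d.re * (ε / (|d.re| + 1)) ≤ ε := by
      rw [← mul_div_assoc, div_le_iff₀ (by positivity)]
      nlinarith [le_abs_self d.re]
    linarith
  have him0 : d.im = 0 := by
    have h1 := him 1
    have h2 := him (-1)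
    linarith
  have hz : (1 : ℂ) ∈ halfPlane := by simp [halfPlane]
  -- Julia's lemma at `1` excludes `d.re ≤ 0`.
  have hj := hF.julia h hz
  have h1 : 0 < (F 1).re := hF.2 hz
  have h2 : 0 < ‖F 1‖ := lt_of_lt_of_le h1 (Complex.re_le_norm _)
  simp only [Complex.one_re, norm_one, mul_one, one_pow] at hj
  refine ⟨d.re, ?_, Complex.ext (by simp) (by simpa using him0)⟩
  by_contra hc
  have : 0 < ‖F 1‖ ^ 2 := by positivity
  nlinarith [not_lt.mp hc]

/-- As `G x ~ a x` with `a > 0`, the points `G x` approach `0` within a cone: eventually `Re (G x) >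
a x / 2` and `‖G x‖ < 2 a x`, whence the aperture `1 / 4`. A limit along the positive reals is
enough to identify the derivative. -/
theorem HasConeDeriv.comp {F G : ℂ → ℂ} {a b : ℝ} (hG : IsHalfPlaneMap G) (ha : 0 < a)
    (h : HasConeDeriv G a) (hF : HasConeDeriv F b) :
    Tendsto (fun x : ℝ => F (G x) / x) (𝓝[>] 0) (𝓝 (b * a : ℂ)) := by
  have hre := h.tendsto_re_div
  have hno := h.tendsto_real.norm
  rw [Complex.ofReal_re] at hre
  rw [Complex.norm_real, Real.norm_of_nonneg ha.le] at hno
  have hcone : ∀ᶠ x : ℝ in 𝓝[>] 0, G x ∈ cone (1 / 4) := by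
    filter_upwards [self_mem_nhdsWithin, hre.eventually_const_lt (show a / 2 < a by linarith),
      hno.eventually_lt_const (show a < 2 * a by linarith)] with x hx h1 h2
    have hx : 0 < x := hx
    refine ⟨hG.2 (by simpa [halfPlane] using hx), ?_⟩
    rw [norm_div, Complex.norm_real, Real.norm_of_nonneg hx.le, div_lt_iff₀ hx] at h2
    rw [lt_div_iff₀ hx] at h1
    linarith
  have := (hF.tendsto_comp (by norm_num) h.tendsto_zero hcone).mul h.tendsto_real
  refine this.congr' ?_
  filter_upwards [hcone] with x hx
  have : G x ≠ 0 := by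
    intro h0
    simpa [h0] using hx.1
  field_simp

/-- A half-plane map is displaced little if its derivatives at `0` and at `∞` are close to `1`. -/
theorem IsHalfPlaneMap.norm_sub_mul_le {F : ℂ → ℂ} (hF : IsHalfPlaneMap F) {d A : ℝ}
    (h : HasConeDeriv F d) (hA : ∀ z ∈ halfPlane, A * z.re ≤ (F z).re) {z : ℂ}
    (hz : z ∈ halfPlane) : ‖F z - A * z‖ * z.re ≤ (d - A) * ‖z‖ ^ 2 := by
  -- `F z - A z` has only nonnegative real part; the term `ε z` makes it strictly positive, and `ε →
  -- 0` at the end.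
  have key : ∀ ε : ℝ, 0 < ε → ‖F z - A * z + ε * z‖ * z.re ≤ (d - A + ε) * ‖z‖ ^ 2 := by
    intro ε hε
    set P : ℂ → ℂ := fun w => F w - A * w + ε * w with hP
    have hPm : IsHalfPlaneMap P := by
      refine ⟨(hF.1.sub (by fun_prop)).add (by fun_prop), fun w hw => ?_⟩
      show 0 < (F w - A * w + ε * w).re
      rw [Complex.add_re, Complex.sub_re, Complex.re_ofReal_mul, Complex.re_ofReal_mul]
      have := hA w hw
      have h2 : 0 < ε * w.re := mul_pos hε hw
      linarith
    have hPd : HasConeDeriv P ((d - A + ε : ℝ) : ℂ) := by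
      intro c hc
      have := ((h c hc).sub_const (A : ℂ)).add_const (ε : ℂ)
      push_cast
      refine this.congr' ?_
      filter_upwards [self_mem_nhdsWithin] with w hw
      have : w ≠ 0 := by rintro rfl; simpa using hw.1
      rw [hP]
      field_simp
    have hj := hPm.julia hPd hz
    rw [Complex.ofReal_re] at hj
    have h1 : 0 < (P z).re := hPm.2 hz
    have h2 := Complex.re_le_norm (P z)
    have h3 : 0 < ‖P z‖ := h1.trans_le h2
    have h4 : 0 < z.re := hz
    -- The sign allows `Re (P z)` to be replaced by `‖P z‖` in Julia's inequality, after which one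
    -- factor `‖P z‖` cancels.
    have h5 : 0 ≤ (d - A + ε) * ‖z‖ ^ 2 := by
      by_contra hc
      have := mul_neg_of_neg_of_pos (not_le.mp hc) h1
      have : 0 < ‖P z‖ ^ 2 * z.re := by positivity
      linarith
    have h6 : ‖P z‖ * (‖P z‖ * z.re) ≤ ‖P z‖ * ((d - A + ε) * ‖z‖ ^ 2) := by
      nlinarith [mul_le_mul_of_nonneg_left h2 h5]
    exact le_of_mul_le_mul_left h6 h3
  have hl : Tendsto (fun ε : ℝ => ‖F z - A * z + ε * z‖ * z.re) (𝓝[>] 0)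
      (𝓝 (‖F z - A * z + (0 : ℝ) * z‖ * z.re)) := by
    have : Continuous fun ε : ℝ => ‖F z - A * z + ε * z‖ * z.re := by fun_prop
    exact (this.tendsto 0).mono_left nhdsWithin_le_nhds
  have hr : Tendsto (fun ε : ℝ => (d - A + ε) * ‖z‖ ^ 2) (𝓝[>] 0)
      (𝓝 ((d - A + 0) * ‖z‖ ^ 2)) := by
    have : Continuous fun ε : ℝ => (d - A + ε) * ‖z‖ ^ 2 := by fun_prop
    exact (this.tendsto 0).mono_left nhdsWithin_le_nhds
  have := le_of_tendsto_of_tendsto hl hr (by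
    filter_upwards [self_mem_nhdsWithin] with ε hε using key ε hε)
  simpa using this

/-- **Julia's lemma** at the boundary point `∞` of the right half-plane. -/
theorem IsHalfPlaneMap.julia_infty {F : ℂ → ℂ} (hF : IsHalfPlaneMap F) {G : ℂ → ℂ}
    (hG : IsHalfPlaneMap G) (hGF : ∀ w ∈ halfPlane, G w⁻¹ = (F w)⁻¹) {d : ℝ}
    (h : HasConeDeriv G d) {z : ℂ} (hz : z ∈ halfPlane) : z.re ≤ d * (F z).re := by
  have hz0 : 0 < z.re := hz
  have hFz : 0 < (F z).re := hF.2 hz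
  have n1 : 0 < Complex.normSq z := by
    rw [Complex.normSq_pos]; rintro rfl; simp at hz0
  have n2 : 0 < Complex.normSq (F z) := by
    rw [Complex.normSq_pos]; intro h0; simp [h0] at hFz
  have hi : z⁻¹ ∈ halfPlane := by
    show 0 < (z⁻¹).re
    rw [Complex.inv_re]; positivity
  -- Inversion exchanges `0` and `∞`, and `Re (1/z) = Re z / |z|²`.
  have := hG.julia h hi
  rw [hGF z hz, Complex.inv_re, Complex.inv_re, Complex.sq_norm, Complex.sq_norm,
    Complex.normSq_inv, Complex.normSq_inv, Complex.ofReal_re] at this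
  field_simp at this
  exact this

/-! ### The Möbius chart and transfer to the half-plane -/

/-- The multiplicative constant of `chart`. -/
noncomputable def chartCoeff (σ₁ σ₂ : ℂ) : ℂ := ‖σ₁ - σ₂‖ * σ₁ / (σ₁ - σ₂)

/-- A Möbius map of the disk onto the right half-plane, with `σ₁ ↦ ∞` and `σ₂ ↦ 0`. -/
noncomputable def chart (σ₁ σ₂ z : ℂ) : ℂ := chartCoeff σ₁ σ₂ * (z - σ₂) / (σ₁ - z)

/-- The inverse of `chart`. -/
noncomputable def chartInv (σ₁ σ₂ w : ℂ) : ℂ :=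
  (w * σ₁ + chartCoeff σ₁ σ₂ * σ₂) / (w + chartCoeff σ₁ σ₂)

/-- A self-map of the disk, read in the half-plane through `chart`. -/
noncomputable def halfPlaneConj (σ₁ σ₂ : ℂ) (f : ℂ → ℂ) (w : ℂ) : ℂ :=
  chart σ₁ σ₂ (f (chartInv σ₁ σ₂ w))

theorem circle_norm {σ : ℂ} (h : σ ∈ circle) : ‖σ‖ = 1 := by simpa [circle] using h

theorem circle_mul_conj {σ : ℂ} (h : σ ∈ circle) : σ * (starRingEnd ℂ) σ = 1 := by
  rw [Complex.mul_conj, Complex.normSq_eq_norm_sq, circle_norm h]; simp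

theorem disk_norm {z : ℂ} (h : z ∈ disk) : ‖z‖ < 1 := by simpa [disk] using h

theorem circle_sub_ne_zero {σ z : ℂ} (h : σ ∈ circle) (hz : z ∈ disk) : σ - z ≠ 0 := by
  intro h0
  have := disk_norm hz
  rw [← sub_eq_zero.mp h0, circle_norm h] at this
  exact lt_irrefl _ this

theorem norm_chartCoeff {σ₁ σ₂ : ℂ} (h₁ : σ₁ ∈ circle)
    (hne : σ₁ ≠ σ₂) : ‖chartCoeff σ₁ σ₂‖ = 1 := by
  have : ‖σ₁ - σ₂‖ ≠ 0 := norm_ne_zero_iff.mpr (sub_ne_zero.mpr hne)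
  rw [chartCoeff, norm_div, norm_mul, circle_norm h₁, Complex.norm_real, norm_norm, mul_one,
    div_self this]

/-- With `c` the coefficient, this rewrites `chartInv` as the Cayley transform `σ₁ (w - conj c) / (w
+ c)`, which is why the image of the disk is exactly the right half-plane. -/
theorem chartCoeff_mul {σ₁ σ₂ : ℂ} (h₁ : σ₁ ∈ circle) (h₂ : σ₂ ∈ circle)
    (hne : σ₁ ≠ σ₂) : chartCoeff σ₁ σ₂ * σ₂ = -(starRingEnd ℂ) (chartCoeff σ₁ σ₂) * σ₁ := by
  have e1 := circle_mul_conj h₁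
  have e2 := circle_mul_conj h₂
  have n1 : σ₁ - σ₂ ≠ 0 := sub_ne_zero.mpr hne
  have n2 : (starRingEnd ℂ) σ₁ - (starRingEnd ℂ) σ₂ ≠ 0 := by
    rw [← map_sub]; exact (map_ne_zero _).mpr n1
  simp only [chartCoeff, map_div₀, map_mul, map_sub, Complex.conj_ofReal]
  field_simp
  linear_combination σ₁ * ‖σ₁ - σ₂‖ * (e1 - e2)

theorem chartCoeff_re {σ₁ σ₂ : ℂ} (h₁ : σ₁ ∈ circle) (h₂ : σ₂ ∈ circle) (hne : σ₁ ≠ σ₂) :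
    (chartCoeff σ₁ σ₂).re = ‖σ₁ - σ₂‖ / 2 := by
  have e1 := circle_mul_conj h₁
  have e2 := circle_mul_conj h₂
  have n1 : σ₁ - σ₂ ≠ 0 := sub_ne_zero.mpr hne
  have n2 : (starRingEnd ℂ) σ₁ - (starRingEnd ℂ) σ₂ ≠ 0 := by
    rw [← map_sub]; exact (map_ne_zero _).mpr n1
  have : chartCoeff σ₁ σ₂ + (starRingEnd ℂ) (chartCoeff σ₁ σ₂) = ‖σ₁ - σ₂‖ := by
    simp only [chartCoeff, map_div₀, map_mul, map_sub, Complex.conj_ofReal]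
    field_simp
    linear_combination ‖σ₁ - σ₂‖ * (e1 - e2)
  have h := congrArg Complex.re this
  simp only [Complex.add_re, Complex.conj_re, Complex.ofReal_re] at h
  linarith

theorem chartCoeff_re_pos {σ₁ σ₂ : ℂ} (h₁ : σ₁ ∈ circle) (h₂ : σ₂ ∈ circle) (hne : σ₁ ≠ σ₂) :
    0 < (chartCoeff σ₁ σ₂).re := by
  rw [chartCoeff_re h₁ h₂ hne]
  have := norm_pos_iff.mpr (sub_ne_zero.mpr hne)
  positivity

/-- The normalisation makes exchanging the two points act as exactly `w ↦ 1/w` in the half-plane. -/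
theorem chartCoeff_mul_chartCoeff {σ₁ σ₂ : ℂ} (h₁ : σ₁ ∈ circle) (h₂ : σ₂ ∈ circle)
    (hne : σ₁ ≠ σ₂) : chartCoeff σ₁ σ₂ * chartCoeff σ₂ σ₁ = 1 := by
  have e1 := circle_mul_conj h₁
  have e2 := circle_mul_conj h₂
  have n1 : σ₁ - σ₂ ≠ 0 := sub_ne_zero.mpr hne
  have n2 : σ₂ - σ₁ ≠ 0 := sub_ne_zero.mpr hne.symm
  have e3 : (‖σ₁ - σ₂‖ : ℂ) * ‖σ₁ - σ₂‖ =
      (σ₁ - σ₂) * ((starRingEnd ℂ) σ₁ - (starRingEnd ℂ) σ₂) := by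
    rw [← map_sub, Complex.mul_conj, Complex.normSq_eq_norm_sq]; push_cast; ring
  simp only [chartCoeff]
  rw [norm_sub_rev σ₂ σ₁]
  field_simp
  linear_combination (σ₁ * σ₂) * e3 + (σ₁ - σ₂) * (σ₂ * e1 - σ₁ * e2)

/-- Up to a constant factor, the real part is the Poisson kernel with pole `σ₁`. -/
theorem chart_re {σ₁ σ₂ : ℂ} (h₁ : σ₁ ∈ circle) (h₂ : σ₂ ∈ circle) (hne : σ₁ ≠ σ₂) {z : ℂ} :
    (chart σ₁ σ₂ z).re = (chartCoeff σ₁ σ₂).re * (1 - ‖z‖ ^ 2) / ‖σ₁ - z‖ ^ 2 := by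
  have e1 := circle_mul_conj h₁
  have hc := chartCoeff_mul h₁ h₂ hne
  set c := chartCoeff σ₁ σ₂ with hcdef
  have hc' := congrArg (starRingEnd ℂ) hc
  simp only [map_mul, map_neg, Complex.conj_conj] at hc'
  have key : c * (z - σ₂) * (starRingEnd ℂ) (σ₁ - z) +
      (starRingEnd ℂ) (c * (z - σ₂) * (starRingEnd ℂ) (σ₁ - z)) =
      (c + (starRingEnd ℂ) c) * (1 - z * (starRingEnd ℂ) z) := by
    simp only [map_mul, map_sub, Complex.conj_conj]
    linear_combination -((starRingEnd ℂ) σ₁ - (starRingEnd ℂ) z) * hc - (σ₁ - z) * hc' +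
      (c + (starRingEnd ℂ) c) * e1
  rw [Complex.add_conj, Complex.add_conj, Complex.mul_conj, Complex.normSq_eq_norm_sq] at key
  have key' : 2 * (c * (z - σ₂) * (starRingEnd ℂ) (σ₁ - z)).re = 2 * c.re * (1 - ‖z‖ ^ 2) := by
    exact_mod_cast key
  rw [chart, ← hcdef, div_eq_mul_inv, Complex.inv_def, ← mul_assoc, Complex.re_mul_ofReal,
    Complex.normSq_eq_norm_sq, div_eq_mul_inv]
  congr 1
  linarith

theorem chart_mem {σ₁ σ₂ : ℂ} (h₁ : σ₁ ∈ circle) (h₂ : σ₂ ∈ circle) (hne : σ₁ ≠ σ₂) {z : ℂ}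
    (hz : z ∈ disk) : chart σ₁ σ₂ z ∈ halfPlane := by
  show 0 < (chart σ₁ σ₂ z).re
  rw [chart_re h₁ h₂ hne]
  have := chartCoeff_re_pos h₁ h₂ hne
  have h3 := norm_pos_iff.mpr (circle_sub_ne_zero h₁ hz)
  have h4 := disk_norm hz
  have : 0 < 1 - ‖z‖ ^ 2 := by nlinarith [norm_nonneg z]
  positivity

theorem chartCoeff_re_le_norm_add {σ₁ σ₂ : ℂ} {w : ℂ} (hw : 0 ≤ w.re) :
    (chartCoeff σ₁ σ₂).re ≤ ‖w + chartCoeff σ₁ σ₂‖ := by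
  refine le_trans ?_ (Complex.re_le_norm _)
  rw [Complex.add_re]; linarith

theorem add_chartCoeff_ne_zero {σ₁ σ₂ : ℂ} (h₁ : σ₁ ∈ circle) (h₂ : σ₂ ∈ circle) (hne : σ₁ ≠ σ₂)
    {w : ℂ} (hw : 0 ≤ w.re) : w + chartCoeff σ₁ σ₂ ≠ 0 := by
  rw [← norm_pos_iff]
  exact (chartCoeff_re_pos h₁ h₂ hne).trans_le (chartCoeff_re_le_norm_add hw)

theorem chartInv_mem {σ₁ σ₂ : ℂ} (h₁ : σ₁ ∈ circle) (h₂ : σ₂ ∈ circle) (hne : σ₁ ≠ σ₂) {w : ℂ}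
    (hw : w ∈ halfPlane) : chartInv σ₁ σ₂ w ∈ disk := by
  have hq : (starRingEnd ℂ) (chartCoeff σ₁ σ₂) ∈ halfPlane := by
    show 0 < ((starRingEnd ℂ) (chartCoeff σ₁ σ₂)).re
    rw [Complex.conj_re]; exact chartCoeff_re_pos h₁ h₂ hne
  have := norm_sub_lt_norm_add_conj hw hq
  rw [Complex.conj_conj] at this
  rw [disk, mem_ball_zero_iff, chartInv, chartCoeff_mul h₁ h₂ hne, norm_div, div_lt_one
    (norm_pos_iff.mpr (add_chartCoeff_ne_zero h₁ h₂ hne (le_of_lt hw)))]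
  rwa [neg_mul, ← sub_eq_add_neg, ← sub_mul, norm_mul, circle_norm h₁, mul_one]

theorem chartCoeff_ne_zero {σ₁ σ₂ : ℂ} (h₁ : σ₁ ∈ circle)
    (hne : σ₁ ≠ σ₂) : chartCoeff σ₁ σ₂ ≠ 0 := by
  rw [← norm_ne_zero_iff, norm_chartCoeff h₁ hne]; exact one_ne_zero

theorem chart_chartInv {σ₁ σ₂ : ℂ} (h₁ : σ₁ ∈ circle) (h₂ : σ₂ ∈ circle) (hne : σ₁ ≠ σ₂) {w : ℂ}
    (hw : w ∈ halfPlane) :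
    chart σ₁ σ₂ (chartInv σ₁ σ₂ w) = w := by
  have n := add_chartCoeff_ne_zero h₁ h₂ hne (le_of_lt hw)
  have n1 := circle_sub_ne_zero h₁ (chartInv_mem h₁ h₂ hne hw)
  have e : chartInv σ₁ σ₂ w * (w + chartCoeff σ₁ σ₂) = w * σ₁ + chartCoeff σ₁ σ₂ * σ₂ :=
    div_mul_cancel₀ _ n
  rw [chart, div_eq_iff n1]
  linear_combination e

theorem chartInv_chart {σ₁ σ₂ : ℂ} (h₁ : σ₁ ∈ circle) (h₂ : σ₂ ∈ circle) (hne : σ₁ ≠ σ₂) {z : ℂ}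
    (hz : z ∈ disk) : chartInv σ₁ σ₂ (chart σ₁ σ₂ z) = z := by
  have n := add_chartCoeff_ne_zero h₁ h₂ hne (le_of_lt (chart_mem h₁ h₂ hne hz))
  have n1 := circle_sub_ne_zero h₁ hz
  have e : chart σ₁ σ₂ z * (σ₁ - z) = chartCoeff σ₁ σ₂ * (z - σ₂) := div_mul_cancel₀ _ n1
  rw [chartInv, div_eq_iff n]
  linear_combination e

theorem chart_swap {σ₁ σ₂ : ℂ} (h₁ : σ₁ ∈ circle) (h₂ : σ₂ ∈ circle) (hne : σ₁ ≠ σ₂)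
    {z : ℂ} : chart σ₂ σ₁ z = (chart σ₁ σ₂ z)⁻¹ := by
  have e := chartCoeff_mul_chartCoeff h₁ h₂ hne
  have e' : chartCoeff σ₂ σ₁ = (chartCoeff σ₁ σ₂)⁻¹ := eq_inv_of_mul_eq_one_right e
  rw [chart, chart, e', ← neg_sub σ₁ z, ← neg_sub z σ₂, mul_neg, neg_div_neg_eq, inv_div,
    div_mul_eq_div_div, inv_mul_eq_div]

theorem chartInv_swap {σ₁ σ₂ : ℂ} (h₁ : σ₁ ∈ circle) (h₂ : σ₂ ∈ circle) (hne : σ₁ ≠ σ₂) {w : ℂ}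
    (hw : w ∈ halfPlane) :
    chartInv σ₂ σ₁ w⁻¹ = chartInv σ₁ σ₂ w := by
  rw [← chartInv_chart h₂ h₁ hne.symm (chartInv_mem h₁ h₂ hne hw), chart_swap h₁ h₂ hne,
    chart_chartInv h₁ h₂ hne hw]

theorem halfPlaneConj_swap {σ₁ σ₂ : ℂ} (h₁ : σ₁ ∈ circle) (h₂ : σ₂ ∈ circle) (hne : σ₁ ≠ σ₂)
    {f : ℂ → ℂ} {w : ℂ} (hw : w ∈ halfPlane) :
    halfPlaneConj σ₂ σ₁ f w⁻¹ = (halfPlaneConj σ₁ σ₂ f w)⁻¹ := by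
  rw [halfPlaneConj, halfPlaneConj, chartInv_swap h₁ h₂ hne hw, chart_swap h₁ h₂ hne]

theorem halfPlaneConj_chart {σ₁ σ₂ : ℂ} (h₁ : σ₁ ∈ circle) (h₂ : σ₂ ∈ circle) (hne : σ₁ ≠ σ₂)
    {f : ℂ → ℂ} {z : ℂ} (hz : z ∈ disk) :
    halfPlaneConj σ₁ σ₂ f (chart σ₁ σ₂ z) = chart σ₁ σ₂ (f z) := by
  rw [halfPlaneConj, chartInv_chart h₁ h₂ hne hz]

theorem isHalfPlaneMap_conj {σ₁ σ₂ : ℂ} (h₁ : σ₁ ∈ circle) (h₂ : σ₂ ∈ circle) (hne : σ₁ ≠ σ₂)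
    {f : ℂ → ℂ} (hf : IsHolSelfMap f) :
    IsHalfPlaneMap (halfPlaneConj σ₁ σ₂ f) := by
  have hm : MapsTo (chartInv σ₁ σ₂) halfPlane disk := fun w hw => chartInv_mem h₁ h₂ hne hw
  refine ⟨?_, fun w hw => chart_mem h₁ h₂ hne (hf.2 (hm hw))⟩
  have hd : DifferentiableOn ℂ (chartInv σ₁ σ₂) halfPlane :=
    DifferentiableOn.div (by fun_prop) (by fun_prop)
      fun w hw => add_chartCoeff_ne_zero h₁ h₂ hne (le_of_lt hw)
  have hc : DifferentiableOn ℂ (chart σ₁ σ₂) disk :=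
    DifferentiableOn.div (by fun_prop) (by fun_prop) fun z hz => circle_sub_ne_zero h₁ hz
  exact hc.comp (hf.1.comp hd hm) (hf.2.comp hm)

/-- Carries displacement bounds back to the disk; the pole `-c` of `chartInv` lies at distance at
least `Re c` from the half-plane. -/
theorem norm_chartInv_sub_le {σ₁ σ₂ : ℂ} (h₁ : σ₁ ∈ circle) (h₂ : σ₂ ∈ circle) (hne : σ₁ ≠ σ₂)
    {w w' : ℂ} (hw : w ∈ halfPlane) (hw' : w' ∈ halfPlane) :
    ‖chartInv σ₁ σ₂ w - chartInv σ₁ σ₂ w'‖ ≤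
      ‖σ₁ - σ₂‖ / (chartCoeff σ₁ σ₂).re ^ 2 * ‖w - w'‖ := by
  have n := add_chartCoeff_ne_zero h₁ h₂ hne (le_of_lt hw)
  have n' := add_chartCoeff_ne_zero h₁ h₂ hne (le_of_lt hw')
  have e : chartInv σ₁ σ₂ w - chartInv σ₁ σ₂ w' = chartCoeff σ₁ σ₂ * (σ₁ - σ₂) * (w - w') /
      ((w + chartCoeff σ₁ σ₂) * (w' + chartCoeff σ₁ σ₂)) := by
    rw [chartInv, chartInv]
    field_simp
    ring
  have hp := chartCoeff_re_pos h₁ h₂ hne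
  rw [e, norm_div, norm_mul, norm_mul, norm_mul, norm_chartCoeff h₁ hne, one_mul, div_mul_eq_mul_div,
    sq]
  gcongr
  · exact chartCoeff_re_le_norm_add (le_of_lt hw)
  · exact chartCoeff_re_le_norm_add (le_of_lt hw')

/-- For `w = chart z`, the ratio `Re w / ‖w‖` is `Re (chartCoeff σ₁ σ₂) (1 - ‖z‖²) / (‖σ₁ - z‖ ‖σ₂ -
z‖)`, so a cone at `0` lies, near `0`, over a Stolz region at `σ₂`. -/
theorem tendsto_chartInv_angularFilter {σ₁ σ₂ : ℂ} (h₁ : σ₁ ∈ circle) (h₂ : σ₂ ∈ circle)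
    (hne : σ₁ ≠ σ₂) {c : ℝ} (hc : 0 < c) :
    Tendsto (chartInv σ₁ σ₂) (𝓝[cone c] 0) (angularFilter σ₂) := by
  have n0 := add_chartCoeff_ne_zero h₁ h₂ hne (w := 0) le_rfl
  have hp := chartCoeff_re_pos h₁ h₂ hne
  have hre := chartCoeff_re h₁ h₂ hne
  have ht : Tendsto (chartInv σ₁ σ₂) (𝓝[cone c] 0) (𝓝 σ₂) := by
    have hcont : ContinuousAt (chartInv σ₁ σ₂) 0 :=
      ContinuousAt.div (by fun_prop) (by fun_prop) n0
    have h0 : chartInv σ₁ σ₂ 0 = σ₂ := by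
      rw [chartInv, zero_mul, zero_add, zero_add,
        mul_div_cancel_left₀ _ (chartCoeff_ne_zero h₁ hne)]
    have := hcont.tendsto
    rw [h0] at this
    exact this.mono_left nhdsWithin_le_nhds
  -- Near `σ₂` the cone condition gives `c ‖σ₂ - z‖ ≤ 1 - ‖z‖² ≤ 2 (1 - ‖z‖)`, so aperture `3 / c`
  -- suffices.
  refine Tendsto.mono_right (tendsto_nhdsWithin_iff.mpr ⟨ht, ?_⟩)
    (le_iSup (fun M : ℝ => 𝓝[stolzRegion σ₂ M] σ₂) (3 / c))
  have hnorm : Tendsto (fun w => ‖σ₁ - chartInv σ₁ σ₂ w‖) (𝓝[cone c] 0) (𝓝 ‖σ₁ - σ₂‖) :=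
    (ht.const_sub _).norm
  filter_upwards [self_mem_nhdsWithin, hnorm.eventually_const_le
    (show (chartCoeff σ₁ σ₂).re < ‖σ₁ - σ₂‖ by linarith)] with w hw hge
  have hwH : w ∈ halfPlane := hw.1
  have hz := chartInv_mem h₁ h₂ hne hwH
  have e := chart_chartInv h₁ h₂ hne hwH
  set z := chartInv σ₁ σ₂ w
  have hz1 := disk_norm hz
  have e1 : w.re = (chartCoeff σ₁ σ₂).re * (1 - ‖z‖ ^ 2) / ‖σ₁ - z‖ ^ 2 := by
    rw [← chart_re h₁ h₂ hne, e]
  have hs : 0 < ‖σ₁ - z‖ := hp.trans_le hge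
  have e2 : ‖w‖ = ‖σ₂ - z‖ / ‖σ₁ - z‖ := by
    rw [← e, chart, norm_div, norm_mul, norm_chartCoeff h₁ hne, one_mul, norm_sub_rev]
  have h3 : c * ‖w‖ ≤ w.re := hw.2
  rw [e1, e2, le_div_iff₀ (by positivity)] at h3
  have h4 : c * (‖σ₂ - z‖ / ‖σ₁ - z‖) * ‖σ₁ - z‖ ^ 2 = c * ‖σ₂ - z‖ * ‖σ₁ - z‖ := by
    field_simp
  rw [h4] at h3
  have h5 : (chartCoeff σ₁ σ₂).re * (c * ‖σ₂ - z‖) ≤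
      (chartCoeff σ₁ σ₂).re * (1 - ‖z‖ ^ 2) := by
    refine le_trans ?_ h3
    rw [mul_comm]
    gcongr
  have h6 := le_of_mul_le_mul_left h5 hp
  refine ⟨hz, ?_⟩
  rw [div_mul_eq_mul_div, lt_div_iff₀ hc]
  nlinarith [norm_nonneg z]

/-- With `z = chartInv w`, the quotient at `w` is `(f z - σ₂) / (z - σ₂)` times `(σ₁ - z) / (σ₁ - f
z)`, and the second factor tends to `1`. -/
theorem hasConeDeriv_conj {σ₁ σ₂ : ℂ} (h₁ : σ₁ ∈ circle) (h₂ : σ₂ ∈ circle) (hne : σ₁ ≠ σ₂)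
    {f : ℂ → ℂ} (hf : IsHolSelfMap f) {d : ℂ}
    (hl : HasAngularLimit f σ₂ σ₂)
    (hd : HasAngularLimit (fun z => (f z - σ₂) / (z - σ₂)) σ₂ d) :
    HasConeDeriv (halfPlaneConj σ₁ σ₂ f) d := by
  intro c hc
  have ht := tendsto_chartInv_angularFilter h₁ h₂ hne hc
  have hle : angularFilter σ₂ ≤ 𝓝 σ₂ := iSup_le fun M => nhdsWithin_le_nhds
  have n : σ₁ - σ₂ ≠ 0 := sub_ne_zero.mpr hne
  have hlim := (hd.comp ht).mul
    (((ht.mono_right hle).const_sub σ₁).div ((hl.comp ht).const_sub σ₁) n)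
  rw [div_self n, mul_one] at hlim
  refine hlim.congr' ?_
  filter_upwards [self_mem_nhdsWithin] with w hw
  have hwH : w ∈ halfPlane := hw.1
  have hz := chartInv_mem h₁ h₂ hne hwH
  have e := chart_chartInv h₁ h₂ hne hwH
  rw [halfPlaneConj]
  simp only [Function.comp_apply, Pi.div_apply]
  set z := chartInv σ₁ σ₂ w
  have n1 := circle_sub_ne_zero h₁ hz
  have n2 : z - σ₂ ≠ 0 := by
    rw [← neg_ne_zero, neg_sub]; exact circle_sub_ne_zero h₂ hz
  have n3 := circle_sub_ne_zero h₁ (hf.2 hz)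
  have n4 := chartCoeff_ne_zero h₁ hne
  rw [← e, chart, chart]
  field_simp

/-- At a boundary regular fixed point the angular derivative exists, is positive, and is also the
derivative at `0` of the map read in the half-plane. -/
theorem exists_angularDeriv {σ₁ σ₂ : ℂ} (h₁ : σ₁ ∈ circle) (h₂ : σ₂ ∈ circle) (hne : σ₁ ≠ σ₂)
    {f : ℂ → ℂ} (hf : f ∈ classP {σ₁, σ₂}) :
    ∃ r : ℝ, 0 < r ∧ HasAngularDeriv f σ₂ r ∧ angularDeriv f σ₂ = r ∧
      HasConeDeriv (halfPlaneConj σ₁ σ₂ f) r := by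
  obtain ⟨hhol, hfix⟩ := hf
  obtain ⟨⟨-, d, hd⟩, hl⟩ := hfix σ₂ (by simp)
  have hd' := hd
  obtain ⟨l, hl', hq⟩ := hd'
  have := angularFilter_neBot h₂
  obtain rfl : l = σ₂ := tendsto_nhds_unique hl' hl
  have hc := hasConeDeriv_conj h₁ h₂ hne hhol hl hq
  obtain ⟨r, hr, rfl⟩ := (isHalfPlaneMap_conj h₁ h₂ hne hhol).exists_pos hc
  exact ⟨r, hr, hd, hd.angularDeriv_eq h₂, hc⟩

/-! ### Criteria for absolute continuity -/

theorem disjoint_uIoc_of_monotoneOn {M : ℝ → ℝ} {s : Set ℝ} (hM : MonotoneOn M s)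
    {a b c d : ℝ} (ha : a ∈ s) (hb : b ∈ s) (hc : c ∈ s) (hd : d ∈ s)
    (h : Disjoint (uIoc a b) (uIoc c d)) : Disjoint (uIoc (M a) (M b)) (uIoc (M c) (M d)) := by
  wlog hab : a ≤ b generalizing a b
  · rw [uIoc_comm]
    exact this hb ha (by rwa [uIoc_comm]) (le_of_not_ge hab)
  wlog hcd : c ≤ d generalizing c d
  · rw [uIoc_comm (M c)]
    exact this hd hc (by rwa [uIoc_comm d]) (le_of_not_ge hcd)
  have hMab := hM ha hb hab
  have hMcd := hM hc hd hcd
  rw [uIoc_of_le hab, uIoc_of_le hcd, Set.Ioc_disjoint_Ioc] at h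
  rw [uIoc_of_le hMab, uIoc_of_le hMcd, Set.Ioc_disjoint_Ioc]
  rcases min_le_iff.mp h with h | h <;> rcases le_max_iff.mp h with h | h
  · exact (min_le_left _ _).trans ((hM hb ha h).trans (le_max_left _ _))
  · exact (min_le_left _ _).trans ((hM hb hc h).trans (le_max_right _ _))
  · exact (min_le_right _ _).trans ((hM hd ha h).trans (le_max_left _ _))
  · exact (min_le_right _ _).trans ((hM hd hc h).trans (le_max_right _ _))

/-- The increments of a monotone function over disjoint intervals add up to at most its total
increment. -/
theorem sum_dist_le_of_monotoneOn {M : ℝ → ℝ} {a b : ℝ} (hab : a ≤ b)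
    (hM : MonotoneOn M (Icc a b)) {E : ℕ × (ℕ → ℝ × ℝ)}
    (hE : E ∈ AbsolutelyContinuousOnInterval.disjWithin a b) :
    ∑ i ∈ Finset.range E.1, dist (M (E.2 i).1) (M (E.2 i).2) ≤ M b - M a := by
  obtain ⟨hmem, hdisj⟩ := hE
  rw [uIcc_of_le hab] at hmem
  have hMab := hM (left_mem_Icc.mpr hab) (right_mem_Icc.mpr hab) hab
  -- Increments are measured as lengths of the image intervals, which are disjoint and lie in `(M a,
  -- M b]`.
  have hvol : ∀ p q : ℝ, volume (uIoc p q) = ENNReal.ofReal (dist p q) := by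
    intro p q
    rw [uIoc, Real.volume_Ioc, max_sub_min_eq_abs', Real.dist_eq]
  have hU : volume (⋃ i ∈ Finset.range E.1, uIoc (M (E.2 i).1) (M (E.2 i).2)) =
      ENNReal.ofReal (∑ i ∈ Finset.range E.1, dist (M (E.2 i).1) (M (E.2 i).2)) := by
    rw [measure_biUnion_finset ?_ fun i _ => measurableSet_uIoc,
      ENNReal.ofReal_sum_of_nonneg fun _ _ => dist_nonneg]
    · exact Finset.sum_congr rfl fun i _ => hvol _ _
    · intro i hi j hj hij
      exact disjoint_uIoc_of_monotoneOn hM (hmem i hi).1 (hmem i hi).2 (hmem j hj).1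
        (hmem j hj).2 (hdisj hi hj hij)
  have hsub : (⋃ i ∈ Finset.range E.1, uIoc (M (E.2 i).1) (M (E.2 i).2)) ⊆ Ioc (M a) (M b) := by
    refine iUnion₂_subset fun i hi => ?_
    have hb : ∀ x ∈ Icc a b, M a ≤ M x ∧ M x ≤ M b := fun x hx =>
      ⟨hM (left_mem_Icc.mpr hab) hx hx.1, hM hx (right_mem_Icc.mpr hab) hx.2⟩
    have h1 := hb _ (hmem i hi).1
    have h2 := hb _ (hmem i hi).2
    exact Ioc_subset_Ioc (le_min h1.1 h2.1) (max_le h1.2 h2.2)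
  have := measure_mono (μ := volume) hsub
  rw [hU, Real.volume_Ioc] at this
  exact (ENNReal.ofReal_le_ofReal_iff (by linarith)).mp this

/-- A function whose increments are dominated by those of an absolutely continuous function, up to
those of monotone functions of arbitrarily small variation, is absolutely continuous. -/
theorem absolutelyContinuousOnInterval_of_dist_le {X Y : Type*} [PseudoMetricSpace X]
    [PseudoMetricSpace Y] {f : ℝ → X} {a b : ℝ} (hab : a ≤ b)
    (h : ∀ ε : ℝ, 0 < ε → ∃ (C : ℝ) (g : ℝ → Y) (M : ℝ → ℝ),
      AbsolutelyContinuousOnInterval g a b ∧ MonotoneOn M (Icc a b) ∧ M b - M a ≤ ε ∧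
      ∀ s ∈ Icc a b, ∀ t ∈ Icc a b, dist (f s) (f t) ≤ C * dist (g s) (g t) + dist (M s) (M t)) :
    AbsolutelyContinuousOnInterval f a b := by
  rw [absolutelyContinuousOnInterval_iff]
  intro ε hε
  obtain ⟨C, g, M, hg, hM, hMε, hle⟩ := h (ε / 2) (by positivity)
  rw [absolutelyContinuousOnInterval_iff] at hg
  -- The part from `g` then contributes less than `ε / 2`, and `M` at most `ε / 2`; `|C| + 1` covers
  -- any sign of `C`.
  obtain ⟨δ, hδ, hgδ⟩ := hg (ε / (2 * (|C| + 1))) (by positivity)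
  refine ⟨δ, hδ, fun E hE hEδ => ?_⟩
  have h1 := hgδ E hE hEδ
  have h2 := sum_dist_le_of_monotoneOn hab hM hE
  have hmem := hE.1
  rw [uIcc_of_le hab] at hmem
  have h3 : ∑ i ∈ Finset.range E.1, dist (f (E.2 i).1) (f (E.2 i).2) ≤
      (|C| + 1) * ∑ i ∈ Finset.range E.1, dist (g (E.2 i).1) (g (E.2 i).2) +
        ∑ i ∈ Finset.range E.1, dist (M (E.2 i).1) (M (E.2 i).2) := by
    rw [Finset.mul_sum, ← Finset.sum_add_distrib]
    refine Finset.sum_le_sum fun i hi => (hle _ (hmem i hi).1 _ (hmem i hi).2).trans ?_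
    gcongr
    linarith [le_abs_self C]
  have h4 : (|C| + 1) * ∑ i ∈ Finset.range E.1, dist (g (E.2 i).1) (g (E.2 i).2) < ε / 2 := by
    have := mul_lt_mul_of_pos_left h1 (show 0 < |C| + 1 by positivity)
    refine this.trans_eq ?_
    field_simp
  linarith

theorem absolutelyContinuousOnInterval_of_dist_le_mul {X Y : Type*} [PseudoMetricSpace X]
    [PseudoMetricSpace Y] {f : ℝ → X} {g : ℝ → Y} {a b C : ℝ} (hab : a ≤ b)
    (hg : AbsolutelyContinuousOnInterval g a b)
    (h : ∀ s ∈ Icc a b, ∀ t ∈ Icc a b, dist (f s) (f t) ≤ C * dist (g s) (g t)) :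
    AbsolutelyContinuousOnInterval f a b :=
  absolutelyContinuousOnInterval_of_dist_le hab fun ε hε =>
    ⟨C, g, fun _ => 0, hg, monotoneOn_const, by simpa using hε.le, by simpa using h⟩

/-- The increments of an absolutely continuous function are bounded by the integrals of a
nonnegative integrable function. -/
theorem exists_dist_le_integral {f : ℝ → ℝ} {a b : ℝ} (hab : a ≤ b)
    (hf : AbsolutelyContinuousOnInterval f a b) :
    ∃ k : ℝ → ℝ, (∀ ξ, 0 ≤ k ξ) ∧ IntegrableOn k (Icc a b) volume ∧
      ∀ s ∈ Icc a b, ∀ t ∈ Icc a b, s ≤ t → |f s - f t| ≤ ∫ ξ in s..t, k ξ := by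
  refine ⟨fun ξ => |deriv f ξ|, fun ξ => abs_nonneg _, ?_, ?_⟩
  · have := hf.intervalIntegrable_deriv
    rw [intervalIntegrable_iff_integrableOn_Icc_of_le hab] at this
    exact this.abs
  · intro s hs t ht hst
    have hsub : AbsolutelyContinuousOnInterval f s t := hf.mono (by
      rw [uIcc_of_le hst, uIcc_of_le hab]; exact Icc_subset_Icc hs.1 ht.2)
    rw [abs_sub_comm, ← hsub.integral_deriv_eq_sub]
    exact intervalIntegral.abs_integral_le_integral_abs hst

/-! ### Angular derivatives along the family -/

/-- A family in `𝔓[{σ₁, σ₂}]` with the algebraic properties of an evolution family. -/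
structure FixedPointFamily (σ₁ σ₂ : ℂ) (φ : ℝ → ℝ → ℂ → ℂ) : Prop where
  h₁ : σ₁ ∈ circle
  h₂ : σ₂ ∈ circle
  hne : σ₁ ≠ σ₂
  mem : ∀ s t : ℝ, 0 ≤ s → s ≤ t → φ s t ∈ classP {σ₁, σ₂}
  ef1 : EF1 φ
  ef2 : EF2 φ

/-- The real part of the angular derivative of `φ s t` at `σ`. -/
noncomputable def derivRe (φ : ℝ → ℝ → ℂ → ℂ) (σ : ℂ) (s t : ℝ) : ℝ := (angularDeriv (φ s t) σ).re

namespace FixedPointFamily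

variable {σ₁ σ₂ : ℂ} {φ : ℝ → ℝ → ℂ → ℂ}

theorem symm (h : FixedPointFamily σ₁ σ₂ φ) : FixedPointFamily σ₂ σ₁ φ :=
  ⟨h.h₂, h.h₁, h.hne.symm, by simpa only [pair_comm] using h.mem, h.ef1, h.ef2⟩

theorem angularDeriv_spec (h : FixedPointFamily σ₁ σ₂ φ) {s t : ℝ} (hs : 0 ≤ s) (hst : s ≤ t) :
    0 < derivRe φ σ₂ s t ∧ HasAngularDeriv (φ s t) σ₂ (derivRe φ σ₂ s t) ∧
      angularDeriv (φ s t) σ₂ = derivRe φ σ₂ s t ∧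
      HasConeDeriv (halfPlaneConj σ₁ σ₂ (φ s t)) (derivRe φ σ₂ s t) := by
  obtain ⟨r, hr, ha, he, hc⟩ := exists_angularDeriv h.h₁ h.h₂ h.hne (h.mem s t hs hst)
  have : derivRe φ σ₂ s t = r := by rw [derivRe, he, Complex.ofReal_re]
  rw [this]
  exact ⟨hr, ha, he, hc⟩

theorem isHalfPlaneMap (h : FixedPointFamily σ₁ σ₂ φ) {s t : ℝ} (hs : 0 ≤ s) (hst : s ≤ t) :
    IsHalfPlaneMap (halfPlaneConj σ₁ σ₂ (φ s t)) :=
  isHalfPlaneMap_conj h.h₁ h.h₂ h.hne (h.mem s t hs hst).1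

theorem halfPlaneConj_comp (h : FixedPointFamily σ₁ σ₂ φ) {s u t : ℝ} (hs : 0 ≤ s) (hsu : s ≤ u)
    (hut : u ≤ t) {w : ℂ} (hw : w ∈ halfPlane) :
    halfPlaneConj σ₁ σ₂ (φ s t) w =
      halfPlaneConj σ₁ σ₂ (φ u t) (halfPlaneConj σ₁ σ₂ (φ s u) w) := by
  have hz := chartInv_mem h.h₁ h.h₂ h.hne hw
  rw [halfPlaneConj, halfPlaneConj, halfPlaneConj,
    chartInv_chart h.h₁ h.h₂ h.hne ((h.mem s u hs hsu).1.2 hz), h.ef2 s u t hs hsu hut _ hz]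

theorem halfPlaneConj_self (h : FixedPointFamily σ₁ σ₂ φ) {s : ℝ} (hs : 0 ≤ s) {w : ℂ}
    (hw : w ∈ halfPlane) : halfPlaneConj σ₁ σ₂ (φ s s) w = w := by
  rw [halfPlaneConj, h.ef1 s hs _ (chartInv_mem h.h₁ h.h₂ h.hne hw),
    chart_chartInv h.h₁ h.h₂ h.hne hw]

/-- Chain rule at the common fixed point, by uniqueness of the limit along the positive reals. -/
theorem derivRe_mul (h : FixedPointFamily σ₁ σ₂ φ) {s u t : ℝ} (hs : 0 ≤ s) (hsu : s ≤ u)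
    (hut : u ≤ t) : derivRe φ σ₂ s t = derivRe φ σ₂ u t * derivRe φ σ₂ s u := by
  obtain ⟨hp, -, -, hc⟩ := h.angularDeriv_spec hs hsu
  have hc' := (h.angularDeriv_spec (hs.trans hsu) hut).2.2.2
  have hc'' := (h.angularDeriv_spec hs (hsu.trans hut)).2.2.2
  have h1 := HasConeDeriv.comp (h.isHalfPlaneMap hs hsu) hp hc hc'
  have h2 := hc''.tendsto_real
  have h3 := tendsto_nhds_unique (h2.congr' (by
    filter_upwards [self_mem_nhdsWithin] with x hx
    rw [h.halfPlaneConj_comp hs hsu hut (by simpa [halfPlane] using hx)])) h1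
  exact_mod_cast h3

theorem derivRe_self (h : FixedPointFamily σ₁ σ₂ φ) {s : ℝ} (hs : 0 ≤ s) :
    derivRe φ σ₂ s s = 1 := by
  have h1 := h.derivRe_mul hs le_rfl le_rfl
  have h2 := (h.angularDeriv_spec hs (le_refl s)).1
  exact (mul_eq_left₀ h2.ne').mp h1.symm

theorem julia (h : FixedPointFamily σ₁ σ₂ φ) {s t : ℝ} (hs : 0 ≤ s) (hst : s ≤ t) {w : ℂ}
    (hw : w ∈ halfPlane) : ‖halfPlaneConj σ₁ σ₂ (φ s t) w‖ ^ 2 * w.re ≤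
      derivRe φ σ₂ s t * ‖w‖ ^ 2 * (halfPlaneConj σ₁ σ₂ (φ s t) w).re := by
  have := (h.isHalfPlaneMap hs hst).julia (h.angularDeriv_spec hs hst).2.2.2 hw
  rwa [Complex.ofReal_re] at this

theorem julia_infty (h : FixedPointFamily σ₁ σ₂ φ) {s t : ℝ} (hs : 0 ≤ s) (hst : s ≤ t) {w : ℂ}
    (hw : w ∈ halfPlane) :
    w.re ≤ derivRe φ σ₁ s t * (halfPlaneConj σ₁ σ₂ (φ s t) w).re :=
  (h.isHalfPlaneMap hs hst).julia_infty (h.symm.isHalfPlaneMap hs hst)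
    (fun _ hw => halfPlaneConj_swap h.h₁ h.h₂ h.hne hw) (h.symm.angularDeriv_spec hs hst).2.2.2 hw

/-- With `A = 1/d₁`, Julia's lemma at `∞` is the lower bound required by
`IsHalfPlaneMap.norm_sub_mul_le`. The term `|A - 1|` appears twice: in `d₂ - A ≤ |d₂ - 1| + |A -
1|`, and in passing from `A w` to `w`. -/
theorem norm_halfPlaneConj_sub_le (h : FixedPointFamily σ₁ σ₂ φ) {s t : ℝ} (hs : 0 ≤ s)
    (hst : s ≤ t) {w : ℂ} (hw : w ∈ halfPlane) :
    ‖halfPlaneConj σ₁ σ₂ (φ s t) w - w‖ * w.re ≤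
      (|derivRe φ σ₂ s t - 1| + 2 * |(derivRe φ σ₁ s t)⁻¹ - 1|) * ‖w‖ ^ 2 := by
  have hp := (h.symm.angularDeriv_spec hs hst).1
  set A := (derivRe φ σ₁ s t)⁻¹ with hA
  have h1 := (h.isHalfPlaneMap hs hst).norm_sub_mul_le (A := A)
    (h.angularDeriv_spec hs hst).2.2.2 (fun z hz => by
      rw [hA, inv_mul_le_iff₀ hp]; exact h.julia_infty hs hst hz) hw
  set W := halfPlaneConj σ₁ σ₂ (φ s t) w
  have hre : 0 < w.re := hw
  have h2 : ‖W - w‖ ≤ ‖W - A * w‖ + |A - 1| * ‖w‖ := by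
    have e : W - w = (W - A * w) + ((A - 1 : ℝ) : ℂ) * w := by push_cast; ring
    rw [e]
    refine (norm_add_le _ _).trans ?_
    rw [norm_mul, Complex.norm_real, Real.norm_eq_abs]
  have h3 : |A - 1| * ‖w‖ * w.re ≤ |A - 1| * ‖w‖ ^ 2 := by
    rw [sq, ← mul_assoc]
    gcongr
    exact Complex.re_le_norm w
  have h4 : (derivRe φ σ₂ s t - A) * ‖w‖ ^ 2 ≤
      (|derivRe φ σ₂ s t - 1| + |A - 1|) * ‖w‖ ^ 2 := by
    gcongr
    linarith [le_abs_self (derivRe φ σ₂ s t - 1), neg_abs_le (A - 1)]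
  nlinarith [mul_le_mul_of_nonneg_right h2 hre.le]

/-! ### Absolutely continuous derivatives imply EF3 -/

theorem absolutelyContinuousOnInterval_derivRe
    (hac : LocallyAC fun t => angularDeriv (φ 0 t) σ₂) {T : ℝ} (hT : 0 ≤ T) :
    AbsolutelyContinuousOnInterval (derivRe φ σ₂ 0) 0 T :=
  absolutelyContinuousOnInterval_of_dist_le_mul (C := 1) hT (hac 0 T le_rfl hT)
    fun s _ t _ => by
      rw [one_mul, Real.dist_eq, derivRe, derivRe, ← Complex.sub_re, Complex.dist_eq]
      exact Complex.abs_re_le_norm _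

/-- Bounds, from above and away from zero, for the angular derivatives on a compact interval. -/
theorem exists_bounds (h : FixedPointFamily σ₁ σ₂ φ)
    (hac : LocallyAC fun t => angularDeriv (φ 0 t) σ₂) {T : ℝ} (hT : 0 ≤ T) :
    ∃ m B : ℝ, 0 < m ∧ ∀ t ∈ Icc 0 T, m ≤ derivRe φ σ₂ 0 t ∧ derivRe φ σ₂ 0 t ≤ B := by
  have hc := (absolutelyContinuousOnInterval_derivRe hac hT).continuousOn
  rw [uIcc_of_le hT] at hc
  have hne : (Icc 0 T).Nonempty := ⟨0, left_mem_Icc.mpr hT⟩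
  obtain ⟨t₀, ht₀, hmin⟩ := isCompact_Icc.exists_isMinOn hne hc
  obtain ⟨t₁, ht₁, hmax⟩ := isCompact_Icc.exists_isMaxOn hne hc
  exact ⟨_, _, (h.angularDeriv_spec le_rfl ht₀.1).1, fun t ht => ⟨hmin ht, hmax ht⟩⟩

theorem derivRe_eq_div (h : FixedPointFamily σ₁ σ₂ φ) {s t : ℝ} (hs : 0 ≤ s) (hst : s ≤ t) :
    derivRe φ σ₂ s t = derivRe φ σ₂ 0 t / derivRe φ σ₂ 0 s := by
  rw [eq_div_iff (h.angularDeriv_spec le_rfl hs).1.ne', h.derivRe_mul le_rfl hs hst]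

theorem ef3 (h : FixedPointFamily σ₁ σ₂ φ) (hac₁ : LocallyAC fun t => angularDeriv (φ 0 t) σ₁)
    (hac₂ : LocallyAC fun t => angularDeriv (φ 0 t) σ₂) : EF3 φ := by
  intro z hz T hT
  obtain ⟨m₁, B₁, hm₁, hb₁⟩ := h.symm.exists_bounds hac₁ hT.le
  obtain ⟨m₂, B₂, hm₂, hb₂⟩ := h.exists_bounds hac₂ hT.le
  obtain ⟨k₁, hk₁, hi₁, hd₁⟩ := exists_dist_le_integral hT.le
    (absolutelyContinuousOnInterval_derivRe hac₁ hT.le)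
  obtain ⟨k₂, hk₂, hi₂, hd₂⟩ := exists_dist_le_integral hT.le
    (absolutelyContinuousOnInterval_derivRe hac₂ hT.le)
  have hB₁ : 0 < B₁ := by
    have := hb₁ 0 (left_mem_Icc.mpr hT.le); linarith
  have hB₂ : 0 < B₂ := by
    have := hb₂ 0 (left_mem_Icc.mpr hT.le); linarith
  have hw := chart_mem h.h₁ h.h₂ h.hne hz
  set w := chart σ₁ σ₂ z with hwdef
  have hre : 0 < w.re := hw
  -- For all `s ≤ u` in `[0, T]` the image `W` of `w` satisfies `ρ ≤ Re W` (Julia at `∞`) and `‖W‖ ≤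
  -- R` (Julia at `0`); `Bⱼ / mⱼ` bounds the derivative of `φ s u` at `σⱼ`.
  set ρ := w.re / (B₁ / m₁) with hρ
  set R := B₂ / m₂ * ‖w‖ ^ 2 / w.re with hR
  have hρ0 : 0 < ρ := by positivity
  have hR0 : 0 ≤ R := by positivity
  set L := ‖σ₁ - σ₂‖ / (chartCoeff σ₁ σ₂).re ^ 2 with hL
  have hL0 : 0 ≤ L := by positivity
  set C := L * (R ^ 2 / ρ) with hC
  have hC0 : 0 ≤ C := by positivity
  refine ⟨fun ξ => C * (m₂⁻¹ * k₂ ξ + 2 * (m₁⁻¹ * k₁ ξ)), fun ξ _ => ?_,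
    ((hi₂.const_mul _).add ((hi₁.const_mul _).const_mul _)).const_mul _, ?_⟩
  · have := hk₁ ξ
    have := hk₂ ξ
    positivity
  intro s u t hs hsu hut htT
  have hu0 := hs.trans hsu
  have hsI : s ∈ Icc 0 T := ⟨hs, (hsu.trans hut).trans htT⟩
  have huI : u ∈ Icc 0 T := ⟨hu0, hut.trans htT⟩
  have htI : t ∈ Icc 0 T := ⟨hu0.trans hut, htT⟩
  have hWm : halfPlaneConj σ₁ σ₂ (φ s u) w ∈ halfPlane := (h.isHalfPlaneMap hs hsu).2 hw
  have hj₁ := h.julia_infty hs hsu hw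
  have hj₂ := h.julia hs hsu hw
  have hcomp := h.halfPlaneConj_comp hs hsu hut hw
  set W := halfPlaneConj σ₁ σ₂ (φ s u) w with hW
  have hdisp := h.norm_halfPlaneConj_sub_le hu0 hut hWm
  have hVm : halfPlaneConj σ₁ σ₂ (φ u t) W ∈ halfPlane := (h.isHalfPlaneMap hu0 hut).2 hWm
  have hWre : 0 < W.re := hWm
  have hρW : ρ ≤ W.re := by
    rw [hρ, div_le_iff₀ (by positivity), mul_comm]
    refine hj₁.trans ?_
    gcongr
    rw [h.symm.derivRe_eq_div hs hsu]
    exact div_le_div₀ hB₁.le (hb₁ u huI).2 hm₁ (hb₁ s hsI).1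
  have hWn : 0 < ‖W‖ := hWre.trans_le (Complex.re_le_norm _)
  have hWR : ‖W‖ ≤ R := by
    rw [hR, le_div_iff₀ hre]
    have h1 : ‖W‖ ^ 2 * w.re ≤ B₂ / m₂ * ‖w‖ ^ 2 * ‖W‖ := by
      refine hj₂.trans ?_
      gcongr
      · rw [h.derivRe_eq_div hs hsu]
        exact div_le_div₀ hB₂.le (hb₂ u huI).2 hm₂ (hb₂ s hsI).1
      · exact Complex.re_le_norm _
    refine le_of_mul_le_mul_left ?_ hWn
    linarith
  have hd2 : |derivRe φ σ₂ u t - 1| ≤ m₂⁻¹ * ∫ ξ in u..t, k₂ ξ := by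
    have hp := hm₂.trans_le (hb₂ u huI).1
    rw [h.derivRe_eq_div hu0 hut, div_sub_one hp.ne', abs_div, abs_of_pos hp, abs_sub_comm,
      div_eq_inv_mul]
    gcongr
    · exact (hb₂ u huI).1
    · exact hd₂ u huI t htI hut
  -- Because of the inverse, the denominator is the derivative at time `t`, not `u`.
  have hd1 : |(derivRe φ σ₁ u t)⁻¹ - 1| ≤ m₁⁻¹ * ∫ ξ in u..t, k₁ ξ := by
    have hp := hm₁.trans_le (hb₁ t htI).1
    rw [h.symm.derivRe_eq_div hu0 hut, inv_div, div_sub_one hp.ne', abs_div, abs_of_pos hp,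
      div_eq_inv_mul]
    gcongr
    · exact (hb₁ t htI).1
    · exact hd₁ u huI t htI hut
  have hφ : ∀ r, s ≤ r → φ s r z = chartInv σ₁ σ₂ (halfPlaneConj σ₁ σ₂ (φ s r) w) := by
    intro r hr
    rw [hwdef, halfPlaneConj_chart h.h₁ h.h₂ h.hne hz,
      chartInv_chart h.h₁ h.h₂ h.hne ((h.mem s r hs hr).1.2 hz)]
  have hi : ∀ k : ℝ → ℝ, IntegrableOn k (Icc 0 T) volume → IntervalIntegrable k volume u t := by
    intro k hk
    rw [intervalIntegrable_iff_integrableOn_Icc_of_le hut]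
    exact hk.mono_set (Icc_subset_Icc hu0 htT)
  rw [hφ u hsu, hφ t (hsu.trans hut), hcomp, ← hW, intervalIntegral.integral_const_mul,
    intervalIntegral.integral_add ((hi k₂ hi₂).const_mul _) (((hi k₁ hi₁).const_mul _).const_mul _),
    intervalIntegral.integral_const_mul, intervalIntegral.integral_const_mul,
    intervalIntegral.integral_const_mul]
  refine (norm_chartInv_sub_le h.h₁ h.h₂ h.hne hWm hVm).trans ?_
  rw [norm_sub_rev W, hC, mul_assoc L, ← hL]
  refine mul_le_mul_of_nonneg_left ?_ hL0
  rw [div_mul_eq_mul_div, le_div_iff₀ hρ0]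
  calc ‖halfPlaneConj σ₁ σ₂ (φ u t) W - W‖ * ρ
      ≤ ‖halfPlaneConj σ₁ σ₂ (φ u t) W - W‖ * W.re := by gcongr
    _ ≤ _ := hdisp
    _ ≤ (m₂⁻¹ * (∫ ξ in u..t, k₂ ξ) + 2 * (m₁⁻¹ * ∫ ξ in u..t, k₁ ξ)) * R ^ 2 := by
        have hk : (0 : ℝ) ≤ |derivRe φ σ₂ u t - 1| + 2 * |(derivRe φ σ₁ u t)⁻¹ - 1| := by positivity
        refine mul_le_mul ?_ (by gcongr) (by positivity) (hk.trans ?_) <;> gcongr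
    _ = _ := mul_comm _ _

/-! ### EF3 implies absolutely continuous derivatives -/

theorem absolutelyContinuousOnInterval_orbit (h : IsEvolutionFamily φ) {z : ℂ} (hz : z ∈ disk)
    {T : ℝ} (hT : 0 < T) : AbsolutelyContinuousOnInterval (fun t => φ 0 t z) 0 T := by
  obtain ⟨k, -, hk, hle⟩ := h.ef3 z hz T hT
  have hki : IntervalIntegrable k volume 0 T := by
    rwa [intervalIntegrable_iff_integrableOn_Icc_of_le hT.le]
  have hsub : ∀ t ∈ Icc 0 T, IntervalIntegrable k volume 0 t := by
    intro t ht
    rw [intervalIntegrable_iff_integrableOn_Icc_of_le ht.1]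
    exact hk.mono_set (Icc_subset_Icc le_rfl ht.2)
  have hord : ∀ u ∈ Icc 0 T, ∀ t ∈ Icc 0 T, u ≤ t →
      dist (φ 0 u z) (φ 0 t z) ≤ 1 * dist (∫ ξ in 0..u, k ξ) (∫ ξ in 0..t, k ξ) := by
    intro u hu t ht hut
    rw [one_mul, dist_comm (∫ ξ in 0..u, k ξ), Real.dist_eq,
      intervalIntegral.integral_interval_sub_left (hsub t ht) (hsub u hu), dist_eq_norm]
    exact (hle 0 u t le_rfl hu.1 hut ht.2).trans (le_abs_self _)
  refine absolutelyContinuousOnInterval_of_dist_le_mul (C := 1) hT.le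
    (hki.absolutelyContinuousOnInterval_intervalIntegral left_mem_uIcc) fun u hu t ht => ?_
  rcases le_total u t with hut | htu
  · exact hord u hu t ht hut
  · rw [dist_comm, dist_comm (∫ ξ in 0..u, k ξ)]
    exact hord t ht u hu htu

/-- By compactness the path keeps a positive distance `m` from the pole `σ₁`, and the chart is
Lipschitz there. -/
theorem absolutelyContinuousOnInterval_chart (h₁ : σ₁ ∈ circle) (hne : σ₁ ≠ σ₂) {y : ℝ → ℂ}
    {T : ℝ} (hT : 0 ≤ T) (hy : AbsolutelyContinuousOnInterval y 0 T)
    (hyd : ∀ t ∈ Icc 0 T, y t ∈ disk) :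
    AbsolutelyContinuousOnInterval (fun t => (chart σ₁ σ₂ (y t)).re) 0 T := by
  have hc := hy.continuousOn
  rw [uIcc_of_le hT] at hc
  obtain ⟨t₀, ht₀, hmin⟩ := isCompact_Icc.exists_isMinOn ⟨0, left_mem_Icc.mpr hT⟩
    (f := fun t => ‖σ₁ - y t‖)
    (continuousOn_const.sub hc).norm
  have hm := norm_pos_iff.mpr (circle_sub_ne_zero h₁ (hyd t₀ ht₀))
  set m := ‖σ₁ - y t₀‖
  have hmle : ∀ t ∈ Icc 0 T, m ≤ ‖σ₁ - y t‖ := fun t ht => hmin ht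
  refine absolutelyContinuousOnInterval_of_dist_le_mul (C := ‖σ₁ - σ₂‖ / (m * m)) hT hy
    fun s hs t ht => ?_
  have n1 := circle_sub_ne_zero h₁ (hyd s hs)
  have n2 := circle_sub_ne_zero h₁ (hyd t ht)
  have e : chart σ₁ σ₂ (y s) - chart σ₁ σ₂ (y t) =
      chartCoeff σ₁ σ₂ * (σ₁ - σ₂) * (y s - y t) / ((σ₁ - y s) * (σ₁ - y t)) := by
    rw [chart, chart]
    field_simp
    ring
  rw [Real.dist_eq, ← Complex.sub_re]
  refine (Complex.abs_re_le_norm _).trans ?_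
  rw [e, norm_div, norm_mul, norm_mul, norm_mul, norm_chartCoeff h₁ hne, one_mul, dist_eq_norm,
    div_mul_eq_mul_div]
  gcongr
  · exact hmle s hs
  · exact hmle t ht

/-- Julia's lemma for `φ s t` at the image `V` of `w` at time `s` reads `Re (1/V) ≤ d₂ Re (1/W)`;
multiply by the derivative of `φ 0 s` and use the chain rule. -/
theorem derivRe_mul_re_inv_mono (h : FixedPointFamily σ₁ σ₂ φ) {s t : ℝ} (hs : 0 ≤ s)
    (hst : s ≤ t) {w : ℂ} (hw : w ∈ halfPlane) :
    derivRe φ σ₂ 0 s * ((halfPlaneConj σ₁ σ₂ (φ 0 s) w)⁻¹).re ≤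
      derivRe φ σ₂ 0 t * ((halfPlaneConj σ₁ σ₂ (φ 0 t) w)⁻¹).re := by
  have hp := (h.angularDeriv_spec le_rfl hs).1
  have hm := (h.isHalfPlaneMap le_rfl hs).2 hw
  have hj := h.julia hs hst hm
  rw [← h.halfPlaneConj_comp le_rfl hs hst hw] at hj
  have hm' := (h.isHalfPlaneMap le_rfl (hs.trans hst)).2 hw
  set V := halfPlaneConj σ₁ σ₂ (φ 0 s) w
  set W := halfPlaneConj σ₁ σ₂ (φ 0 t) w
  have h1 : 0 < ‖V‖ := lt_of_lt_of_le hm (Complex.re_le_norm _)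
  have h2 : 0 < ‖W‖ := lt_of_lt_of_le hm' (Complex.re_le_norm _)
  rw [h.derivRe_mul le_rfl hs hst, mul_comm (derivRe φ σ₂ s t), mul_assoc]
  refine mul_le_mul_of_nonneg_left ?_ hp.le
  rw [Complex.inv_re, Complex.inv_re, Complex.normSq_eq_norm_sq, Complex.normSq_eq_norm_sq,
    mul_div_assoc', div_le_div_iff₀ (by positivity) (by positivity)]
  linarith

theorem locallyAC (h : FixedPointFamily σ₁ σ₂ φ) (he : IsEvolutionFamily φ) :
    LocallyAC fun t => angularDeriv (φ 0 t) σ₂ := by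
  intro a b ha hab
  -- EF3 needs `T > 0`, while `b` may be `0`.
  obtain ⟨T, hT, hbT⟩ : ∃ T : ℝ, 0 < T ∧ b ≤ T := ⟨b + 1, by linarith, by linarith⟩
  suffices hAC : AbsolutelyContinuousOnInterval (fun t => angularDeriv (φ 0 t) σ₂) 0 T from
    hAC.mono (by rw [uIcc_of_le hab, uIcc_of_le hT.le]; exact Icc_subset_Icc ha hbT)
  set ℓ := derivRe φ σ₂ 0 with hℓ
  have hℓp : ∀ t, 0 ≤ t → 0 < ℓ t := fun t ht => (h.angularDeriv_spec le_rfl ht).1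
  set F : ℝ → ℂ → ℂ := fun t => halfPlaneConj σ₁ σ₂ (φ 0 t) with hF
  set R : ℝ → ℝ → ℝ := fun x t => x * ((F t x)⁻¹).re with hR
  have hxH : ∀ x : ℝ, 0 < x → (x : ℂ) ∈ halfPlane := fun x hx => by simpa [halfPlane] using hx
  have hRp : ∀ x, 0 < x → ∀ t, 0 ≤ t → 0 < R x t := by
    intro x hx t ht
    have h1 : 0 < (F t x).re := (h.isHalfPlaneMap le_rfl ht).2 (hxH x hx)
    have h2 : F t x ≠ 0 := by intro h0; simp [h0] at h1
    have h3 := Complex.normSq_pos.mpr h2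
    show 0 < x * ((F t x)⁻¹).re
    rw [Complex.inv_re]
    positivity
  have hRac : ∀ x, 0 < x → AbsolutelyContinuousOnInterval (R x) 0 T := by
    intro x hx
    have hz := chartInv_mem h.h₁ h.h₂ h.hne (hxH x hx)
    -- The exchanged chart is used because it is the inverse `1/F` whose real part enters `R`.
    have h1 := absolutelyContinuousOnInterval_chart h.h₂ h.hne.symm hT.le
      (absolutelyContinuousOnInterval_orbit he hz hT) fun t ht => (h.mem 0 t le_rfl ht.1).1.2 hz
    have h2 := h1.const_mul x
    refine absolutelyContinuousOnInterval_of_dist_le_mul (C := 1) hT.le h2 fun s _ t _ => ?_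
    simp only [hR, hF, halfPlaneConj, chart_swap h.h₁ h.h₂ h.hne, one_mul, le_refl]
  have hNmono : ∀ x, 0 < x → MonotoneOn (fun t => ℓ t * R x t) (Icc 0 T) := by
    intro x hx s hs t ht hst
    have := mul_le_mul_of_nonneg_left (h.derivRe_mul_re_inv_mono hs.1 hst (hxH x hx)) hx.le
    simp only [hR, hF]
    linarith
  have hN0 : ∀ x, 0 < x → ℓ 0 * R x 0 = 1 := by
    intro x hx
    simp only [hR, hF, hℓ]
    rw [h.derivRe_self le_rfl, h.halfPlaneConj_self le_rfl (hxH x hx), ← Complex.ofReal_inv,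
      Complex.ofReal_re]
    field_simp
  have hN1 : ∀ x, 0 < x → ∀ t ∈ Icc 0 T, 1 ≤ ℓ t * R x t := fun x hx t ht =>
    (hN0 x hx).symm.trans_le (hNmono x hx (left_mem_Icc.mpr hT.le) ht ht.1)
  have hNT : Tendsto (fun x => ℓ T * R x T) (𝓝[>] 0) (𝓝 1) := by
    have hc := (h.angularDeriv_spec le_rfl hT.le).2.2.2.tendsto_real
    have hn : ((derivRe φ σ₂ 0 T : ℝ) : ℂ) ≠ 0 := by exact_mod_cast (hℓp T hT.le).ne'
    have h1 := ((Complex.continuous_re.tendsto _).comp (hc.inv₀ hn)).const_mul (ℓ T)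
    rw [← Complex.ofReal_inv, Complex.ofReal_re, mul_inv_cancel₀ (hℓp T hT.le).ne'] at h1
    refine h1.congr fun x => ?_
    simp only [Function.comp_apply, hR, hF]
    rw [inv_div, div_eq_mul_inv, Complex.re_ofReal_mul]
  have hsmall : ∀ η : ℝ, 0 < η → ∃ x, 0 < x ∧ ℓ T * R x T ≤ 1 + η := by
    intro η hη
    obtain ⟨x, hx, hx'⟩ := ((eventually_mem_nhdsWithin (s := Ioi (0 : ℝ))).and
      (hNT.eventually_le_const (show (1 : ℝ) < 1 + η by linarith))).exists
    exact ⟨x, hx, hx'⟩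
  -- Fix `x` with `ℓ T * R x T ≤ 2`; by monotonicity `ℓ t ≤ 2 / R x t`, and the continuous `R x` has
  -- a positive minimum.
  obtain ⟨Λ, hΛ, hℓΛ⟩ : ∃ Λ : ℝ, 0 < Λ ∧ ∀ t ∈ Icc 0 T, ℓ t ≤ Λ := by
    obtain ⟨x, hx, hxT⟩ := hsmall 1 one_pos
    have hc := (hRac x hx).continuousOn
    rw [uIcc_of_le hT.le] at hc
    obtain ⟨t₀, ht₀, hmin⟩ := isCompact_Icc.exists_isMinOn ⟨0, left_mem_Icc.mpr hT.le⟩ hc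
    have hm := hRp x hx t₀ ht₀.1
    refine ⟨2 / R x t₀, by positivity, fun t ht => ?_⟩
    rw [le_div_iff₀ hm]
    have h1 : ℓ t * R x t ≤ ℓ T * R x T := hNmono x hx ht (right_mem_Icc.mpr hT.le) ht.2
    have h2 : R x t₀ ≤ R x t := hmin ht
    have h3 := mul_le_mul_of_nonneg_left h2 (hℓp t ht.1).le
    linarith
  refine absolutelyContinuousOnInterval_of_dist_le (Y := ℝ) hT.le fun ε hε => ?_
  -- The monotone part is `Λ` times `ℓ * R x`, so its variation is at most `Λ (ε / Λ) = ε`.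
  obtain ⟨x, hx, hxT⟩ := hsmall (ε / Λ) (by positivity)
  refine ⟨Λ * Λ, R x, fun t => Λ * (ℓ t * R x t), hRac x hx,
    fun s hs t ht hst => mul_le_mul_of_nonneg_left (hNmono x hx hs ht hst) hΛ.le, ?_, ?_⟩
  · simp only [hN0 x hx]
    have := mul_le_mul_of_nonneg_left hxT hΛ.le
    rw [mul_add, mul_div_cancel₀ _ hΛ.ne'] at this
    linarith
  · intro s hs t ht
    have hs' := (h.angularDeriv_spec le_rfl hs.1).2.2.1
    have ht' := (h.angularDeriv_spec le_rfl ht.1).2.2.1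
    simp only
    rw [hs', ht', Complex.dist_eq, ← Complex.ofReal_sub, Complex.norm_real, Real.norm_eq_abs,
      Real.dist_eq, Real.dist_eq, ← mul_sub Λ, abs_mul Λ, abs_of_pos hΛ]
    change |ℓ s - ℓ t| ≤ _
    have hRs := hRp x hx s hs.1
    -- The lower bound `R x s ≥ 1 / Λ` does not depend on `x`, so dividing by `R x s` costs only a
    -- factor `Λ`.
    have h1 : 1 ≤ Λ * R x s :=
      (hN1 x hx s hs).trans (mul_le_mul_of_nonneg_right (hℓΛ s hs) hRs.le)
    have e : (ℓ s - ℓ t) * R x s = (ℓ s * R x s - ℓ t * R x t) - ℓ t * (R x s - R x t) := by ring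
    have h2 : |ℓ s - ℓ t| * R x s ≤
        |ℓ s * R x s - ℓ t * R x t| + Λ * |R x s - R x t| := by
      rw [← abs_of_pos hRs, ← abs_mul, abs_of_pos hRs, e]
      refine (abs_sub _ _).trans ?_
      rw [abs_mul, abs_of_pos (hℓp t ht.1)]
      gcongr
      exact hℓΛ t ht
    have h3 := mul_le_mul_of_nonneg_left h2 hΛ.le
    have h4 := mul_le_mul_of_nonneg_left h1 (abs_nonneg (ℓ s - ℓ t))
    linarith

end FixedPointFamily

end Loewner

theorem proposition1 (σ₁ σ₂ : ℂ) (hσ₁ : σ₁ ∈ Loewner.circle) (hσ₂ : σ₂ ∈ Loewner.circle)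
    (hne : σ₁ ≠ σ₂) (φ : ℝ → ℝ → ℂ → ℂ)
    (hφ : ∀ s t : ℝ, 0 ≤ s → s ≤ t → φ s t ∈ Loewner.classP {σ₁, σ₂})
    (hEF1 : Loewner.EF1 φ) (hEF2 : Loewner.EF2 φ) :
    (∀ σ ∈ ({σ₁, σ₂} : Set ℂ), ∀ t : ℝ, 0 ≤ t →
      ∃ r : ℝ, 0 < r ∧ Loewner.HasAngularDeriv (φ 0 t) σ (r : ℂ)) ∧
    (Loewner.IsEvolutionFamily φ ↔
      Loewner.LocallyAC (fun t => Loewner.angularDeriv (φ 0 t) σ₁) ∧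
      Loewner.LocallyAC (fun t => Loewner.angularDeriv (φ 0 t) σ₂)) := by
  have h : Loewner.FixedPointFamily σ₁ σ₂ φ := ⟨hσ₁, hσ₂, hne, hφ, hEF1, hEF2⟩
  refine ⟨?_, fun he => ⟨h.symm.locallyAC he, h.locallyAC he⟩, fun hac =>
    ⟨fun s t hs hst => (hφ s t hs hst).1, hEF1, hEF2, h.ef3 hac.1 hac.2⟩⟩
  rintro σ (rfl | rfl) t ht
  · have := h.symm.angularDeriv_spec le_rfl ht
    exact ⟨_, this.1, this.2.1⟩
  · have := h.angularDeriv_spec le_rfl ht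
    exact ⟨_, this.1, this.2.1⟩
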